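/- A source $S$, a decode-and-forward relay $R$ and a destination $D$ communicate in signalling intervals $i=0,1,2,\dots$ The channels $h_{SR}(i),h_{RD}(i),h_{SD}(i)$ are circularly symmetric complex Gaussian with mean $0$ and variances $d_{SR}^{-\alpha},d_{RD}^{-\alpha},d_{SD}^{-\alpha}$, the energy $X(i)$ harvested by $R$ is exponential with rate $\lambda_1$, and all of these are independent of each other, over $i$ as well, and of the initial buffer level $B(0)\ge 0$. The powers $P_S,\sigma^2$, the distances, $\lambda_1$, the energy $M$ per relay transmission and the rate $R_0$ are positive. Let $\Gamma_{th}=2^{2R_0}-1$, and let $\Gamma'_{th}=\Gamma_{th}$ (incremental signalling) or $\Gamma'_{th}=\infty$ (non-incremental signalling). Let $\gamma_{SD}(i)=P_S|h_{SD}(i)|^2/\sigma^2$ and $\gamma_{SR}(i)=P_S|h_{SR}(i)|^2/\sigma^2$. Under the on-off policy (IOFP) with an infinite buffer, $B(i+1)=B(i)-M+X(i)$ if $\gamma_{SD}(i)<\Gamma'_{th}$ and $B(i)\ge M$, and $B(i+1)=B(i)+X(i)$ otherwise; the relay transmits with power $P_R(i)=2M$ if $B(i)\ge M$ and is silent ($P_R(i)=0$)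 otherwise, and $\gamma_{RD}(i)=P_R(i)|h_{RD}(i)|^2/\sigma^2$. The outage probability in interval $i$ is $$P_{out}(i)=\Pr\{\gamma_{SD}(i)<\Gamma'_{th}\}\,\Pr\{\min(\gamma_{SR}(i),\gamma_{RD}(i)+\gamma_{SD}(i))<\Gamma_{th}\mid\gamma_{SD}(i)<\Gamma'_{th}\}.$$ Put $W_1=\frac{\sigma^2d_{RD}^{\alpha}}{2M}$, $W_2=\frac{\sigma^2d_{SD}^{\alpha}}{P_S}$, $W_4=\frac{\sigma^2d_{SR}^{\alpha}}{P_S}$, $\phi_{inc}=M\lambda_1(1-e^{-W_2\Gamma'_{th}})$ (with $e^{-\infty}=0$), and, when $W_1\ne W_2$, $$F=(1-e^{-W_2\Gamma_{th}})+\frac{W_2\,[e^{-W_1\Gamma_{th}}-e^{-W_2\Gamma_{th}}]}{W_1-W_2}.$$ (1) If $\phi_{inc}>1$, the buffer chain has exactly one stationary law $\pi$ on $[0,\infty)$, $\pi([M,\infty))=1/\phi_{inc}$, and $\Pr\{B(i)\ge M\}\to 1/\phi_{inc}$ as $i\to\infty$ for every law of $B(0)$. If moreover $W_1\neq W_2$,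 the outage probability $$P_{out}=(1-e^{-W_4\Gamma_{th}})(1-e^{-W_2\Gamma'_{th}})+e^{-W_4\Gamma_{th}}\Big[\tfrac1{\phi_{inc}}F+\big(1-\tfrac1{\phi_{inc}}\big)(1-e^{-W_2\Gamma_{th}})\Big]$$ is attained in every interval, $P_{out}(i)=P_{out}$, when $B(0)$ has law $\pi$, and is the limit of $P_{out}(i)$ as $i\to\infty$ for every law of $B(0)$. (2) If $\phi_{inc}\le 1$, then $\Pr\{B(i)\ge M\}\to 1$ as $i\to\infty$ for every law of $B(0)$ and, if $W_1\neq W_2$, $$\lim_{i\to\infty}P_{out}(i)=(1-e^{-W_4\Gamma_{th}})(1-e^{-W_2\Gamma'_{th}})+e^{-W_4\Gamma_{th}}F .$$ -/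

import Mathlib

open MeasureTheory ProbabilityTheory Filter Topology Set

namespace IOFP

noncomputable section

/-- Circularly symmetric complex Gaussian law with mean `0` and variance `v`: the real and
imaginary parts are independent centred real Gaussians of variance `v / 2` each. -/
def complexGaussian (v : ℝ) : Measure ℂ :=
  ((gaussianReal 0 (v / 2).toNNReal).prod (gaussianReal 0 (v / 2).toNNReal)).map
    Complex.measurableEquivRealProd.symm

/-- Incremental signalling (one feedback bit from the destination), or non-incremental
signalling (the destination always sends a NACK). -/
inductive Signalling
  | incremental
  | nonIncremental

/-- Parameters of the source / relay / destination network. -/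
structure Params where
  /-- source transmit power -/
  PS : ℝ
  /-- noise variance `σ²` -/
  noise : ℝ
  /-- normalized distances -/
  dSR : ℝ
  dRD : ℝ
  dSD : ℝ
  /-- path-loss exponent -/
  α : ℝ
  /-- target rate -/
  R₀ : ℝ
  /-- rate of the exponential harvested energy, whose mean is `1 / lam₁` -/
  lam₁ : ℝ
  /-- energy drawn from the buffer for each relay transmission -/
  M : ℝ
  PS_pos : 0 < PS
  noise_pos : 0 < noise
  dSR_pos : 0 < dSR
  dRD_pos : 0 < dRD
  dSD_pos : 0 < dSD
  R₀_pos : 0 < R₀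
  lam₁_pos : 0 < lam₁
  M_pos : 0 < M

namespace Params

variable (p : Params)

/-- SNR threshold `2 ^ (2 R₀) - 1`. -/
def Gth : ℝ := 2 ^ (2 * p.R₀) - 1

/-- Threshold for sending an ACK: `Gth` for incremental signalling, `∞` otherwise. -/
def ackThreshold : Signalling → EReal
  | .incremental => (p.Gth : EReal)
  | .nonIncremental => ⊤

def W₁ : ℝ := p.noise * p.dRD ^ p.α / (2 * p.M)

def W₂ : ℝ := p.noise * p.dSD ^ p.α / p.PS

def W₄ : ℝ := p.noise * p.dSR ^ p.α / p.PS

/-- `exp (-W₂ Γ)` at the ACK threshold `Γ`, equal to `0` when `Γ = ∞`. -/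
def expAck (s : Signalling) : ℝ :=
  (EReal.exp (-((p.W₂ : EReal) * p.ackThreshold s))).toReal

/-- `M * lam₁ * (1 - exp (-W₂ Γ))`, with `Γ` the ACK threshold. -/
def phi (s : Signalling) : ℝ := p.M * p.lam₁ * (1 - p.expAck s)

/-- One step of the energy buffer under the on-off policy: current level `b`, harvested energy
`x`, source-destination SNR `γ`. -/
def bufferStep (s : Signalling) (b x γ : ℝ) : ℝ :=
  open Classical in
  if p.ackThreshold s ≤ (γ : EReal) then b + x
  else if p.M ≤ b then b - p.M + x
  else b + x

/-- Instantaneous SNR of a link from the source with channel coefficient `h`. -/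
def snrFromSource (h : ℂ) : ℝ := p.PS * ‖h‖ ^ 2 / p.noise

/-- Relay power under the on-off policy with buffer level `b`: energy `M` spent in a phase of
duration `1 / 2` if available, and silence otherwise. -/
def relayPower (b : ℝ) : ℝ := open Classical in if p.M ≤ b then p.M / (1 / 2) else 0

/-- Instantaneous SNR of the relay-destination link. -/
def snrFromRelay (b : ℝ) (h : ℂ) : ℝ := p.relayPower b * ‖h‖ ^ 2 / p.noise

/-- Joint law of `(h_SR, h_RD, h_SD, X)` in one signalling interval: independent Rayleigh-fading
channels and an independent exponential harvested energy. -/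
def slotLaw : Measure (ℂ × ℂ × ℂ × ℝ) :=
  (complexGaussian (p.dSR ^ (-p.α))).prod
    ((complexGaussian (p.dRD ^ (-p.α))).prod
      ((complexGaussian (p.dSD ^ (-p.α))).prod (expMeasure p.lam₁)))

/-- `π` is a stationary law of the energy-buffer chain: a probability measure on `[0, ∞)`
preserved by one step of the buffer driven by an independent signalling interval. -/
structure IsStationaryLaw (s : Signalling) (π : Measure ℝ) : Prop where
  isProb : IsProbabilityMeasure π
  nonneg : ∀ᵐ b ∂π, 0 ≤ b
  invariant : (π.prod p.slotLaw).map
    (fun z => p.bufferStep s z.1 z.2.2.2.2 (p.snrFromSource z.2.2.2.1)) = π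

/-- Outage probability when the relay always transmits with power `2 M`. -/
def outageAlways (s : Signalling) : ℝ :=
  (1 - Real.exp (-p.W₄ * p.Gth)) * (1 - p.expAck s)
    + Real.exp (-p.W₄ * p.Gth) *
      ((1 - Real.exp (-p.W₂ * p.Gth))
        + p.W₂ * (Real.exp (-p.W₁ * p.Gth) - Real.exp (-p.W₂ * p.Gth)) / (p.W₁ - p.W₂))

/-- Closed form of the outage probability of the on-off policy with a stable buffer. -/
def outageOnOff (s : Signalling) : ℝ :=
  (1 - Real.exp (-p.W₄ * p.Gth)) * (1 - p.expAck s)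
    + Real.exp (-p.W₄ * p.Gth) *
      (1 / p.phi s *
          ((1 - Real.exp (-p.W₂ * p.Gth))
            + p.W₂ * (Real.exp (-p.W₁ * p.Gth) - Real.exp (-p.W₂ * p.Gth)) / (p.W₁ - p.W₂))
        + (1 - 1 / p.phi s) * (1 - Real.exp (-p.W₂ * p.Gth)))

end Params

/-- The random inputs of the network on a probability space: the channels and the harvested
energy in every signalling interval, and the initial energy in the buffer. -/
structure Inputs (p : Params) {Ω : Type*} [MeasurableSpace Ω] (P : Measure Ω) where
  hSR : ℕ → Ω → ℂ
  hRD : ℕ → Ω → ℂ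
  hSD : ℕ → Ω → ℂ
  X : ℕ → Ω → ℝ
  B₀ : Ω → ℝ
  measurable_hSR : ∀ i, Measurable (hSR i)
  measurable_hRD : ∀ i, Measurable (hRD i)
  measurable_hSD : ∀ i, Measurable (hSD i)
  measurable_X : ∀ i, Measurable (X i)
  measurable_B₀ : Measurable B₀
  B₀_nonneg : ∀ᵐ ω ∂P, 0 ≤ B₀ ω
  /-- law of the inputs in a single interval -/
  slot_law : ∀ i, P.map (fun ω => (hSR i ω, hRD i ω, hSD i ω, X i ω)) = p.slotLaw
  /-- different intervals are independent -/
  slot_indep : iIndepFun (fun i ω => (hSR i ω, hRD i ω, hSD i ω, X i ω)) P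
  /-- the initial energy is independent of all the intervals -/
  init_indep : IndepFun B₀ (fun ω i => (hSR i ω, hRD i ω, hSD i ω, X i ω)) P

namespace Inputs

variable {p : Params} {Ω : Type*} [MeasurableSpace Ω] {P : Measure Ω} (N : Inputs p P)
  (s : Signalling)

def snrSR (i : ℕ) (ω : Ω) : ℝ := p.snrFromSource (N.hSR i ω)

def snrSD (i : ℕ) (ω : Ω) : ℝ := p.snrFromSource (N.hSD i ω)

/-- Energy in the buffer in interval `i`. -/
def buffer : ℕ → Ω → ℝ
  | 0, ω => N.B₀ ω
  | i + 1, ω => p.bufferStep s (buffer i ω) (N.X i ω) (N.snrSD i ω)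

def snrRD (i : ℕ) (ω : Ω) : ℝ := p.snrFromRelay (N.buffer s i ω) (N.hRD i ω)

/-- The destination sends a NACK in interval `i`. -/
def nack (i : ℕ) : Set Ω := {ω | (N.snrSD i ω : EReal) < p.ackThreshold s}

/-- Probability that the buffer holds at least `M` in interval `i`. -/
def availProb (i : ℕ) : ℝ := P.real {ω | p.M ≤ N.buffer s i ω}

/-- Outage probability in interval `i`: the probability of a NACK times the conditional
probability, given the NACK, of decoding failure at the relay or after combining. -/
def outageProb (i : ℕ) : ℝ :=
  P.real (N.nack s i) *
    (P[|N.nack s i]).real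
      {ω | min (N.snrSR i ω) (N.snrRD s i ω + N.snrSD i ω) < p.Gth}

end Inputs

end

end IOFP

/-! Polar coordinates show that the squared norm of a complex Gaussian is exponential, so the three
SNRs of an interval (the relay's taken while it transmits) are independent exponentials with rates
`W₄`, `W₁`, `W₂`. An ACK then has probability q = `expAck`, and the buffer is a Markov chain: remove
`M` with probability 1 - q if the level is at least `M`, then add an independent exponential of rate
`lam₁`. The ratio of mean demand to mean supply is `phi`.

Stable case, `phi` > 1. For small θ > 0 the function exp (θ b) shrinks by a fixed factor above `M`
(`exists_growth_lt_one`), and memorylessness makes all starting points below K share a component of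
their next law, namely K plus an exponential. Together these give a Harris contraction on functions
modulo constants (`exists_contraction`). Hence laws of two copies of the chain merge on every event,
which yields uniqueness and convergence. Existence is explicit: a uniform variable on (0, M] plus an
independent exponential of rate r, where r is the positive root of r = `lam₁` (1 - q) (1 - exp (-r
M)). Its mass on [M, ∞) is (1 - exp (-r M)) / (r M) = 1 / `phi`.

Case `phi` ≤ 1, critical value included. The function y + 1 / `lam₁` is a supersolution for the
recursion satisfied by the probabilities of levels below y. It gives a bound ε (y + 1 / `lam₁`) plus
a geometrically decaying term, for every ε > 0 (`iterate_nextLaw_real_Iio_le`), so low levels lose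
all their mass.

Outage. The level in interval i depends only on the initial level and earlier intervals, hence is
independent of interval i, and it affects the outage only through whether it reaches `M`. The outage
probability is therefore an affine function of the availability probability
(`Inputs.outageProb_eq`), and all outage claims follow from those about availability. -/

namespace IOFP

/-! ### Rayleigh fading: squared norms of complex Gaussians -/

open scoped ENNReal

/-- Polar coordinates followed by u = r²: the area element r dr dθ becomes du dθ / 2, and the angle
contributes 2π. -/
lemma lintegral_radial (F : ℝ → ℝ≥0∞) (hF : Measurable F) :
    ∫⁻ z : ℝ × ℝ, F (z.1 ^ 2 + z.2 ^ 2) = ENNReal.ofReal Real.pi * ∫⁻ u in Ioi (0 : ℝ), F u := by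
  have himg : (fun r : ℝ => r ^ 2) '' Ioi 0 = Ioi 0 := by
    ext u
    constructor
    · rintro ⟨r, hr, rfl⟩
      exact pow_pos (mem_Ioi.1 hr) 2
    · intro hu
      exact ⟨√u, Real.sqrt_pos.2 hu, Real.sq_sqrt (le_of_lt hu)⟩
  have hsub : ∫⁻ u in Ioi (0 : ℝ), F u
      = ∫⁻ r in Ioi (0 : ℝ), ENNReal.ofReal (2 * r) * F (r ^ 2) := by
    conv_lhs => rw [← himg]
    rw [lintegral_image_eq_lintegral_abs_deriv_mul (f := fun r : ℝ => r ^ 2)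
      (f' := fun r : ℝ => 2 * r) measurableSet_Ioi
      (fun r _ => by simpa using (hasDerivAt_pow 2 r).hasDerivWithinAt)]
    · refine setLIntegral_congr_fun measurableSet_Ioi fun r hr => ?_
      have : (0 : ℝ) < r := hr
      rw [abs_of_pos (by positivity)]
    · intro a ha b hb hab
      exact (pow_left_inj₀ (le_of_lt ha) (le_of_lt hb) two_ne_zero).1 hab
  rw [← lintegral_comp_polarCoord_symm]
  have htarget : polarCoord.target = Ioi (0 : ℝ) ×ˢ Ioo (-Real.pi) Real.pi := rfl
  rw [htarget, Measure.volume_eq_prod, ← Measure.prod_restrict, lintegral_prod]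
  · have hin : ∀ r : ℝ, ∫⁻ θ in Ioo (-Real.pi) Real.pi,
        ENNReal.ofReal (r, θ).1 • F ((polarCoord.symm (r, θ)).1 ^ 2 + (polarCoord.symm (r, θ)).2 ^ 2)
        = ENNReal.ofReal Real.pi * (ENNReal.ofReal (2 * r) * F (r ^ 2)) := by
      intro r
      have : ∀ θ : ℝ, (polarCoord.symm (r, θ)).1 ^ 2 + (polarCoord.symm (r, θ)).2 ^ 2 = r ^ 2 := by
        intro θ
        simp only [polarCoord_symm_apply]
        nlinarith [Real.sin_sq_add_cos_sq θ]
      simp only [this, smul_eq_mul, lintegral_const, Measure.restrict_apply MeasurableSet.univ,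
        univ_inter, Real.volume_Ioo]
      have h2 : Real.pi - -Real.pi = 2 * Real.pi := by ring
      rw [h2, ENNReal.ofReal_mul (by norm_num), ENNReal.ofReal_mul (by norm_num)]
      ring
    simp only [hin]
    rw [lintegral_const_mul _ (by fun_prop), hsub]
  · refine Measurable.aemeasurable ?_
    simp only [smul_eq_mul]
    refine Measurable.mul (by fun_prop) (hF.comp ?_)
    have := continuous_polarCoord_symm.measurable
    fun_prop

instance isProbabilityMeasure_complexGaussian (v : ℝ) :
    IsProbabilityMeasure (complexGaussian v) := by
  unfold complexGaussian
  exact Measure.isProbabilityMeasure_map (by fun_prop)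

/-- The joint density of the two coordinates depends only on u = ‖h‖² and equals exp (-u / v) / (π
v). The factor π from the radial formula turns it into the exponential density of rate 1 / v. -/
lemma complexGaussian_norm_sq_le {v : ℝ} (hv : 0 < v) {t : ℝ} (ht : 0 ≤ t) :
    complexGaussian v {h | ‖h‖ ^ 2 ≤ t} = ENNReal.ofReal (1 - Real.exp (-(t / v))) := by
  have hv' : (v / 2).toNNReal ≠ 0 := by simpa using hv
  have hcoe : ((v / 2).toNNReal : ℝ) = v / 2 := Real.coe_toNNReal _ (by positivity)
  have hS : MeasurableSet {h : ℂ | ‖h‖ ^ 2 ≤ t} := measurableSet_le (by fun_prop) (by fun_prop)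
  have hS' := Complex.measurableEquivRealProd.symm.measurable hS
  set F : ℝ → ℝ≥0∞ := fun u => (Iic t).indicator
    (fun u => ENNReal.ofReal ((Real.pi * v)⁻¹ * Real.exp (-(u / v)))) u with hFdef
  have hF : Measurable F := Measurable.indicator (by fun_prop) measurableSet_Iic
  have key : complexGaussian v {h | ‖h‖ ^ 2 ≤ t} = ∫⁻ z : ℝ × ℝ, F (z.1 ^ 2 + z.2 ^ 2) := by
    unfold complexGaussian
    rw [Measure.map_apply (by fun_prop) hS, gaussianReal_of_var_ne_zero _ hv',
      prod_withDensity (measurable_gaussianPDF _ _) (measurable_gaussianPDF _ _),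
      withDensity_apply _ hS', ← lintegral_indicator hS',
      Measure.volume_eq_prod]
    refine lintegral_congr fun z => ?_
    have hn : ‖Complex.measurableEquivRealProd.symm z‖ ^ 2 = z.1 ^ 2 + z.2 ^ 2 := by
      rw [← Complex.normSq_eq_norm_sq]
      simp [Complex.normSq_apply]
      ring
    by_cases hz : z.1 ^ 2 + z.2 ^ 2 ≤ t
    · have h1 : z ∈ Complex.measurableEquivRealProd.symm ⁻¹' {h | ‖h‖ ^ 2 ≤ t} := by
        rwa [mem_preimage, mem_ofPred_eq, hn]
      rw [indicator_of_mem h1, hFdef]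
      simp only
      rw [indicator_of_mem (by exact hz), gaussianPDF, gaussianPDF,
        ← ENNReal.ofReal_mul (gaussianPDFReal_nonneg _ _ _)]
      congr 1
      simp only [gaussianPDFReal, hcoe]
      have h2 : 2 * Real.pi * (v / 2) = Real.pi * v := by ring
      rw [h2, mul_mul_mul_comm, ← Real.exp_add, ← mul_inv,
        Real.mul_self_sqrt (by positivity)]
      congr 2
      field_simp
      ring
    · have h1 : z ∉ Complex.measurableEquivRealProd.symm ⁻¹' {h | ‖h‖ ^ 2 ≤ t} := by
        rwa [mem_preimage, mem_ofPred_eq, hn]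
      rw [indicator_of_notMem h1, hFdef]
      simp only
      rw [indicator_of_notMem (by exact hz)]
  have hexp := lintegral_exponentialPDF_eq_antiDeriv (inv_pos.2 hv) t
  rw [if_pos ht, lintegral_Iic_eq_lintegral_Iio_add_Icc _ ht,
    lintegral_exponentialPDF_of_nonpos le_rfl, zero_add] at hexp
  have h3 : v⁻¹ * t = t / v := by field_simp
  rw [key, lintegral_radial F hF, ← lintegral_const_mul _ hF, ← h3, ← hexp,
    setLIntegral_congr Ioc_ae_eq_Icc.symm, ← lintegral_indicator measurableSet_Ioi,
    ← lintegral_indicator measurableSet_Ioc]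
  refine lintegral_congr fun u => ?_
  by_cases hu : 0 < u
  · by_cases hut : u ≤ t
    · rw [indicator_of_mem (by exact hu), indicator_of_mem (by exact ⟨hu, hut⟩), hFdef]
      simp only
      rw [indicator_of_mem (by exact hut), exponentialPDF_of_nonneg hu.le,
        ← ENNReal.ofReal_mul Real.pi_pos.le]
      congr 1
      have : v⁻¹ * u = u / v := by field_simp
      rw [this]
      field_simp
    · rw [indicator_of_mem (by exact hu), indicator_of_notMem (by simp [hut]), hFdef]
      simp only
      rw [indicator_of_notMem (by exact hut), mul_zero]
  · rw [indicator_of_notMem (by exact hu), indicator_of_notMem (by simp [hu])]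

/-- The squared norm of a circularly symmetric complex Gaussian is exponentially distributed. -/
lemma map_const_mul_norm_sq_complexGaussian {v c : ℝ} (hv : 0 < v) (hc : 0 < c) :
    (complexGaussian v).map (fun h => c * ‖h‖ ^ 2) = expMeasure (1 / (c * v)) := by
  have hr : 0 < 1 / (c * v) := by positivity
  have hm : Measurable fun h : ℂ => c * ‖h‖ ^ 2 := by fun_prop
  have := isProbabilityMeasure_expMeasure hr
  have := Measure.isProbabilityMeasure_map (μ := complexGaussian v) hm.aemeasurable
  refine Measure.eq_of_cdf _ _ ?_
  ext x
  rw [cdf_expMeasure_eq hr, cdf_eq_real, map_measureReal_apply hm measurableSet_Iic]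
  by_cases hx : 0 ≤ x
  · have hset : (fun h : ℂ => c * ‖h‖ ^ 2) ⁻¹' Iic x = {h | ‖h‖ ^ 2 ≤ x / c} := by
      ext h
      simp [le_div_iff₀ hc, mul_comm]
    have hd : x / c / v = 1 / (c * v) * x := by field_simp
    rw [if_pos hx, hset, Measure.real, complexGaussian_norm_sq_le hv (by positivity), hd,
      ENNReal.toReal_ofReal]
    have : 0 ≤ 1 / (c * v) * x := by positivity
    simpa using this
  · have hset : (fun h : ℂ => c * ‖h‖ ^ 2) ⁻¹' Iic x = ∅ := by
      ext h
      have : 0 ≤ c * ‖h‖ ^ 2 := by positivity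
      simp only [mem_preimage, mem_Iic, mem_empty_iff_false, iff_false]
      linarith
    rw [if_neg hx, hset]
    simp

namespace Params

variable (p : Params)

lemma W₁_pos : 0 < p.W₁ := by
  have := p.noise_pos; have := p.M_pos; have := Real.rpow_pos_of_pos p.dRD_pos p.α
  unfold W₁; positivity

lemma W₂_pos : 0 < p.W₂ := by
  have := p.noise_pos; have := p.PS_pos; have := Real.rpow_pos_of_pos p.dSD_pos p.α
  unfold W₂; positivity

lemma W₄_pos : 0 < p.W₄ := by
  have := p.noise_pos; have := p.PS_pos; have := Real.rpow_pos_of_pos p.dSR_pos p.α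
  unfold W₄; positivity

lemma Gth_pos : 0 < p.Gth := by
  have : (1 : ℝ) < 2 ^ (2 * p.R₀) :=
    Real.one_lt_rpow (by norm_num) (by have := p.R₀_pos; positivity)
  unfold Gth; linarith

lemma measurable_snrFromSource : Measurable p.snrFromSource := by
  unfold snrFromSource; fun_prop

lemma map_snrFromSource {d : ℝ} (hd : 0 < d) :
    (complexGaussian (d ^ (-p.α))).map p.snrFromSource
      = expMeasure (p.noise * d ^ p.α / p.PS) := by
  have h1 := p.noise_pos
  have h2 := p.PS_pos
  have h3 := Real.rpow_pos_of_pos hd p.α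
  have h : p.snrFromSource = fun h => (p.PS / p.noise) * ‖h‖ ^ 2 := by
    ext h; unfold snrFromSource; ring
  rw [h, map_const_mul_norm_sq_complexGaussian (Real.rpow_pos_of_pos hd _) (by positivity),
    Real.rpow_neg hd.le]
  congr 1
  field_simp

lemma map_snrFromRelay_active :
    (complexGaussian (p.dRD ^ (-p.α))).map (fun h => 2 * p.M * ‖h‖ ^ 2 / p.noise)
      = expMeasure p.W₁ := by
  have h1 := p.noise_pos
  have h2 := p.M_pos
  have h3 := Real.rpow_pos_of_pos p.dRD_pos p.α
  have h : (fun h : ℂ => 2 * p.M * ‖h‖ ^ 2 / p.noise)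
      = fun h => (2 * p.M / p.noise) * ‖h‖ ^ 2 := by
    ext h; ring
  rw [h, map_const_mul_norm_sq_complexGaussian (Real.rpow_pos_of_pos p.dRD_pos _) (by positivity),
    Real.rpow_neg p.dRD_pos.le, W₁]
  congr 1
  field_simp

end Params

/-! ### Integrals against the exponential law -/

section Exponential

variable {r : ℝ} {E : Type*} [NormedAddCommGroup E] [NormedSpace ℝ E]

lemma expMeasure_eq_withDensity (r : ℝ) :
    expMeasure r = volume.withDensity (exponentialPDF r) := rfl

instance nullSingletonClass_expMeasure (r : ℝ) : NullSingletonClass (expMeasure r) := by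
  rw [expMeasure_eq_withDensity]; infer_instance

lemma toReal_exponentialPDF_smul (hr : 0 < r) (f : ℝ → E) (x : ℝ) :
    (exponentialPDF r x).toReal • f x
      = (Ici (0 : ℝ)).indicator (fun x => (r * Real.exp (-(r * x))) • f x) x := by
  by_cases hx : 0 ≤ x
  · rw [indicator_of_mem (by exact hx), exponentialPDF_of_nonneg hx,
      ENNReal.toReal_ofReal (by positivity)]
  · rw [indicator_of_notMem (by exact hx), exponentialPDF_of_neg (not_le.1 hx)]
    simp

lemma measurable_exponentialPDF (r : ℝ) : Measurable (exponentialPDF r) :=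
  (measurable_exponentialPDFReal r).ennreal_ofReal

lemma integral_expMeasure (hr : 0 < r) (f : ℝ → E) :
    ∫ x, f x ∂expMeasure r = ∫ x in Ioi (0 : ℝ), (r * Real.exp (-(r * x))) • f x := by
  rw [expMeasure_eq_withDensity, integral_withDensity_eq_integral_toReal_smul
    (measurable_exponentialPDF r) (ae_of_all _ fun x => ENNReal.ofReal_lt_top)]
  simp_rw [toReal_exponentialPDF_smul hr f]
  rw [integral_indicator measurableSet_Ici, integral_Ici_eq_integral_Ioi]

lemma integrable_expMeasure_iff (hr : 0 < r) (f : ℝ → E) :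
    Integrable f (expMeasure r)
      ↔ IntegrableOn (fun x => (r * Real.exp (-(r * x))) • f x) (Ioi (0 : ℝ)) := by
  rw [expMeasure_eq_withDensity, integrable_withDensity_iff_integrable_smul'
    (measurable_exponentialPDF r) (ae_of_all _ fun x => ENNReal.ofReal_lt_top)]
  simp_rw [toReal_exponentialPDF_smul hr f]
  rw [integrable_indicator_iff measurableSet_Ici, integrableOn_Ici_iff_integrableOn_Ioi]

lemma ae_nonneg_expMeasure (hr : 0 < r) : ∀ᵐ x ∂expMeasure r, 0 ≤ x := by
  have := isProbabilityMeasure_expMeasure hr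
  have h : (expMeasure r).real (Iic 0) = 0 := by
    rw [← cdf_eq_real, cdf_expMeasure_eq hr]; simp
  rw [measureReal_eq_zero_iff] at h
  refine (measure_eq_zero_iff_ae_notMem.1 h).mono fun x hx => ?_
  simpa using (not_le.1 hx).le

/-- Integral against the exponential law over an initial interval. -/
lemma setIntegral_expMeasure_Iio (hr : 0 < r) {z : ℝ} (hz : 0 ≤ z) (f : ℝ → E) :
    ∫ x in Iio z, f x ∂expMeasure r = ∫ x in (0)..z, (r * Real.exp (-(r * x))) • f x := by
  rw [← integral_indicator measurableSet_Iio, integral_expMeasure hr,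
    intervalIntegral.integral_of_le hz, integral_Ioc_eq_integral_Ioo,
    ← integral_indicator measurableSet_Ioi, ← integral_indicator measurableSet_Ioo]
  congr 1
  ext x
  by_cases hx : 0 < x <;> by_cases hxz : x < z <;> simp [indicator, hx, hxz]

lemma expMeasure_real_Iio (hr : 0 < r) {x : ℝ} (hx : 0 ≤ x) :
    (expMeasure r).real (Iio x) = 1 - Real.exp (-(r * x)) := by
  have := isProbabilityMeasure_expMeasure hr
  rw [measureReal_congr Iio_ae_eq_Iic, ← cdf_eq_real, cdf_expMeasure_eq hr, if_pos hx]

lemma expMeasure_real_Ici (hr : 0 < r) {x : ℝ} (hx : 0 ≤ x) :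
    (expMeasure r).real (Ici x) = Real.exp (-(r * x)) := by
  have := isProbabilityMeasure_expMeasure hr
  rw [← compl_Iio, probReal_compl_eq_one_sub measurableSet_Iio, expMeasure_real_Iio hr hx]
  ring

/-- Memorylessness of the exponential law. -/
lemma setIntegral_expMeasure_Ici (hr : 0 < r) {a : ℝ} (ha : 0 ≤ a) (f : ℝ → E) :
    ∫ x in Ici a, f x ∂expMeasure r
      = Real.exp (-(r * a)) • ∫ x, f (a + x) ∂expMeasure r := by
  rw [← integral_indicator measurableSet_Ici, integral_expMeasure hr, integral_expMeasure hr,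
    ← integral_smul]
  have h1 : ∀ x, (r * Real.exp (-(r * x))) • (Ici a).indicator f x
      = (Ici a).indicator (fun x => (r * Real.exp (-(r * x))) • f x) x := by
    intro x
    by_cases hx : a ≤ x <;> simp [indicator, hx]
  simp_rw [h1]
  rw [setIntegral_indicator measurableSet_Ici]
  have h2 : ((Ioi 0 ∩ Ici a : Set ℝ) : Set ℝ) =ᵐ[volume] Ioi a := by
    have h3 : ((Ioi 0 ∩ Ici a : Set ℝ) : Set ℝ) =ᵐ[volume] (Ici 0 ∩ Ici a : Set ℝ) :=
      Ioi_ae_eq_Ici.inter (ae_eq_refl _)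
    rw [Ici_inter_Ici, sup_eq_right.2 ha] at h3
    exact h3.trans Ioi_ae_eq_Ici.symm
  rw [setIntegral_congr_set h2]
  have h4 := (measurePreserving_add_left volume a).setIntegral_preimage_emb
    (measurableEmbedding_addLeft a) (fun x => (r * Real.exp (-(r * x))) • f x) (Ioi a)
  rw [preimage_const_add_Ioi, sub_self] at h4
  rw [← h4]
  refine integral_congr_ae (ae_of_all _ fun x => ?_)
  simp only
  rw [smul_smul, mul_add, neg_add, Real.exp_add]
  congr 1
  ring

lemma integrable_exp_mul_expMeasure (hr : 0 < r) {θ : ℝ} (hθ : θ < r) :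
    Integrable (fun x => Real.exp (θ * x)) (expMeasure r) := by
  rw [integrable_expMeasure_iff hr]
  refine ((integrableOn_exp_mul_Ioi (sub_neg.2 hθ) 0).const_mul r).congr (ae_of_all _ fun x => ?_)
  simp only [smul_eq_mul]
  rw [mul_assoc, ← Real.exp_add]
  ring_nf

lemma integral_exp_mul_expMeasure (hr : 0 < r) {θ : ℝ} (hθ : θ < r) :
    ∫ x, Real.exp (θ * x) ∂expMeasure r = r / (r - θ) := by
  rw [integral_expMeasure hr]
  have h : ∀ x : ℝ, (r * Real.exp (-(r * x))) • Real.exp (θ * x)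
      = r * Real.exp ((θ - r) * x) := by
    intro x
    rw [smul_eq_mul, mul_assoc, ← Real.exp_add]
    ring_nf
  simp_rw [h]
  rw [integral_const_mul, integral_exp_mul_Ioi (sub_neg.2 hθ)]
  have h1 : θ - r ≠ 0 := (sub_neg.2 hθ).ne
  have h2 : r - θ ≠ 0 := (sub_pos.2 hθ).ne'
  simp only [mul_zero, Real.exp_zero]
  field_simp
  ring

lemma integral_cexp_expMeasure (hr : 0 < r) (t : ℝ) :
    ∫ x : ℝ, Complex.exp (t * x * Complex.I) ∂expMeasure r = r / (r - t * Complex.I) := by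
  rw [integral_expMeasure hr]
  have h : ∀ x : ℝ, (r * Real.exp (-(r * x))) • Complex.exp (t * x * Complex.I)
      = r * Complex.exp ((t * Complex.I - r) * x) := by
    intro x
    rw [Complex.real_smul]
    push_cast
    rw [mul_assoc, ← Complex.exp_add]
    ring_nf
  simp_rw [h]
  have hre : (t * Complex.I - r : ℂ).re < 0 := by simpa using hr
  have h1 : (t * Complex.I - r : ℂ) ≠ 0 := fun h => by simp [h] at hre
  have h2 : (r - t * Complex.I : ℂ) ≠ 0 := by
    rw [← neg_sub]; exact neg_ne_zero.2 h1
  rw [integral_const_mul, integral_exp_mul_complex_Ioi hre]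
  simp only [Complex.ofReal_zero, mul_zero, Complex.exp_zero]
  rw [← neg_sub (r : ℂ)]
  field_simp

end Exponential

/-! ### The SNRs of one interval and the probability of an ACK -/

namespace Params

variable (p : Params) (s : Signalling)

instance : IsProbabilityMeasure (expMeasure p.lam₁) := isProbabilityMeasure_expMeasure p.lam₁_pos
instance : IsProbabilityMeasure (expMeasure p.W₁) := isProbabilityMeasure_expMeasure p.W₁_pos
instance : IsProbabilityMeasure (expMeasure p.W₂) := isProbabilityMeasure_expMeasure p.W₂_pos
instance : IsProbabilityMeasure (expMeasure p.W₄) := isProbabilityMeasure_expMeasure p.W₄_pos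

instance : IsProbabilityMeasure p.slotLaw := by unfold slotLaw; infer_instance

/-- The source-relay SNR, the relay-destination SNR of a transmitting relay, the
source-destination SNR and the harvested energy of one interval. -/
noncomputable def slotSnr (z : ℂ × ℂ × ℂ × ℝ) : ℝ × ℝ × ℝ × ℝ :=
  (p.snrFromSource z.1, 2 * p.M * ‖z.2.1‖ ^ 2 / p.noise, p.snrFromSource z.2.2.1, z.2.2.2)

lemma measurable_slotSnr : Measurable p.slotSnr := by
  have := p.measurable_snrFromSource
  unfold slotSnr; fun_prop

lemma map_slotSnr : p.slotLaw.map p.slotSnr = (expMeasure p.W₄).prod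
    ((expMeasure p.W₁).prod ((expMeasure p.W₂).prod (expMeasure p.lam₁))) := by
  have h := p.measurable_snrFromSource
  have hR : Measurable fun h : ℂ => 2 * p.M * ‖h‖ ^ 2 / p.noise := by fun_prop
  have hSR := p.map_snrFromSource p.dSR_pos
  have hSD := p.map_snrFromSource p.dSD_pos
  rw [W₄, ← hSR, ← map_snrFromRelay_active, W₂, ← hSD]
  conv_rhs => rw [← Measure.map_id (μ := expMeasure p.lam₁)]
  rw [Measure.map_prod_map _ _ h measurable_id,
    Measure.map_prod_map _ _ hR (h.prodMap measurable_id),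
    Measure.map_prod_map _ _ h (hR.prodMap (h.prodMap measurable_id))]
  rfl

lemma map_snrSD_energy : p.slotLaw.map (fun z => (p.snrFromSource z.2.2.1, z.2.2.2))
    = (expMeasure p.W₂).prod (expMeasure p.lam₁) := by
  have h : (fun z : ℂ × ℂ × ℂ × ℝ => (p.snrFromSource z.2.2.1, z.2.2.2))
      = (fun y : ℝ × ℝ × ℝ × ℝ => y.2.2) ∘ p.slotSnr := rfl
  rw [h, ← Measure.map_map (by fun_prop) p.measurable_slotSnr, map_slotSnr]
  have h2 : (fun y : ℝ × ℝ × ℝ × ℝ => y.2.2) = Prod.snd ∘ Prod.snd := rfl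
  rw [h2, ← Measure.map_map (by fun_prop) (by fun_prop), Measure.map_snd_prod, measure_univ,
    one_smul, Measure.map_snd_prod, measure_univ, one_smul]

lemma measurableSet_ack : MeasurableSet {γ : ℝ | p.ackThreshold s ≤ (γ : EReal)} :=
  measurableSet_le measurable_const measurable_coe_real_ereal

lemma expMeasure_ack :
    (expMeasure p.W₂).real {γ : ℝ | p.ackThreshold s ≤ (γ : EReal)} = p.expAck s := by
  cases s with
  | incremental =>
    have h : {γ : ℝ | p.ackThreshold .incremental ≤ (γ : EReal)} = Ici p.Gth := by
      ext γ; simp [ackThreshold]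
    rw [h, expMeasure_real_Ici p.W₂_pos p.Gth_pos.le, expAck, ackThreshold, ← EReal.coe_mul,
      ← EReal.coe_neg, EReal.exp_coe, ENNReal.toReal_ofReal (Real.exp_pos _).le]
  | nonIncremental =>
    have h : {γ : ℝ | p.ackThreshold .nonIncremental ≤ (γ : EReal)} = ∅ := by
      ext γ; simp [ackThreshold]
    rw [h, expAck, ackThreshold, EReal.coe_mul_top_of_pos p.W₂_pos]
    simp

lemma expAck_nonneg : 0 ≤ p.expAck s := ENNReal.toReal_nonneg

lemma expAck_lt_one : p.expAck s < 1 := by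
  cases s with
  | incremental =>
    rw [expAck, ackThreshold, ← EReal.coe_mul,
      ← EReal.coe_neg, EReal.exp_coe, ENNReal.toReal_ofReal (Real.exp_pos _).le]
    have := mul_pos p.W₂_pos p.Gth_pos
    simpa using this
  | nonIncremental =>
    rw [expAck, ackThreshold, EReal.coe_mul_top_of_pos p.W₂_pos]
    simp

end Params

lemma integrable_of_norm_le {α E : Type*} [NormedAddCommGroup E] [MeasurableSpace α]
    {μ : Measure α} [IsFiniteMeasure μ] {f : α → E} (hf : StronglyMeasurable f) {C : ℝ}
    (hC : ∀ x, ‖f x‖ ≤ C) : Integrable f μ :=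
  Integrable.of_bound hf.aestronglyMeasurable C (ae_of_all _ hC)

/-! ### The buffer as a Markov chain: transition operator and laws -/

namespace Params

variable (p : Params) (s : Signalling) {E : Type*} [NormedAddCommGroup E] [NormedSpace ℝ E]

/-- Expectation of `f` after adding one harvested energy to the level `z`. -/
noncomputable def avg (f : ℝ → E) (z : ℝ) : E := ∫ x, f (z + x) ∂expMeasure p.lam₁

/-- The transition operator of the energy buffer. -/
noncomputable def op (f : ℝ → E) (b : ℝ) : E :=
  open Classical in
  if p.M ≤ b then (1 - p.expAck s) • p.avg f (b - p.M) + p.expAck s • p.avg f b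
  else p.avg f b

/-- The law of the buffer after one interval. -/
noncomputable def nextLaw (μ : Measure ℝ) : Measure ℝ :=
  (μ.prod p.slotLaw).map
    (fun z => p.bufferStep s z.1 z.2.2.2.2 (p.snrFromSource z.2.2.2.1))

lemma measurable_bufferStep :
    Measurable fun y : ℝ × ℝ × ℝ => p.bufferStep s y.1 y.2.1 y.2.2 := by
  unfold bufferStep
  refine Measurable.ite ?_ (by fun_prop) (Measurable.ite ?_ (by fun_prop) (by fun_prop))
  · exact measurable_snd.snd (p.measurableSet_ack s)
  · exact measurableSet_le measurable_const (by fun_prop)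

lemma measurable_nextLaw_map : Measurable fun z : ℝ × ℂ × ℂ × ℂ × ℝ =>
    p.bufferStep s z.1 z.2.2.2.2 (p.snrFromSource z.2.2.2.1) := by
  have h := p.measurable_snrFromSource
  exact (p.measurable_bufferStep s).comp
    (g := fun y : ℝ × ℝ × ℝ => p.bufferStep s y.1 y.2.1 y.2.2)
    (f := fun z : ℝ × ℂ × ℂ × ℂ × ℝ => (z.1, z.2.2.2.2, p.snrFromSource z.2.2.2.1))
    (by fun_prop)

instance isProbabilityMeasure_nextLaw (μ : Measure ℝ) [IsProbabilityMeasure μ] :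
    IsProbabilityMeasure (p.nextLaw s μ) :=
  Measure.isProbabilityMeasure_map (p.measurable_nextLaw_map s).aemeasurable

lemma bufferStep_nonneg {b x γ : ℝ} (hb : 0 ≤ b) (hx : 0 ≤ x) : 0 ≤ p.bufferStep s b x γ := by
  unfold bufferStep
  split_ifs <;> linarith

lemma ae_energy_nonneg : ∀ᵐ z ∂p.slotLaw, 0 ≤ z.2.2.2 := by
  have h := ae_nonneg_expMeasure p.lam₁_pos
  have hm : Measurable fun z : ℂ × ℂ × ℂ × ℝ => (p.snrFromSource z.2.2.1, z.2.2.2) := by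
    have := p.measurable_snrFromSource
    fun_prop
  have h1 : ∀ᵐ y ∂(expMeasure p.W₂).prod (expMeasure p.lam₁), 0 ≤ y.2 :=
    Measure.quasiMeasurePreserving_snd.ae h
  rw [← p.map_snrSD_energy] at h1
  exact ae_of_ae_map hm.aemeasurable h1

lemma nextLaw_nonneg {μ : Measure ℝ} [IsProbabilityMeasure μ] (h : ∀ᵐ b ∂μ, 0 ≤ b) :
    ∀ᵐ b ∂p.nextLaw s μ, 0 ≤ b := by
  unfold nextLaw
  rw [ae_map_iff (p.measurable_nextLaw_map s).aemeasurable measurableSet_Ici]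
  filter_upwards [Measure.quasiMeasurePreserving_fst.ae h,
    Measure.quasiMeasurePreserving_snd.ae p.ae_energy_nonneg] with z h1 h2
  exact p.bufferStep_nonneg s h1 h2

lemma stronglyMeasurable_avg {f : ℝ → E} (hf : StronglyMeasurable f) :
    StronglyMeasurable (p.avg f) := by
  unfold avg
  exact StronglyMeasurable.integral_prod_right
    (hf.comp_measurable (measurable_fst.add measurable_snd))

lemma stronglyMeasurable_op {f : ℝ → E} (hf : StronglyMeasurable f) :
    StronglyMeasurable (p.op s f) := by
  have h := p.stronglyMeasurable_avg hf
  unfold op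
  refine StronglyMeasurable.ite (measurableSet_le measurable_const measurable_id) ?_ h
  exact ((h.comp_measurable (measurable_id.sub_const _)).const_smul _).add (h.const_smul _)

lemma norm_avg_le {f : ℝ → E} {C : ℝ} (hC : ∀ x, ‖f x‖ ≤ C) (z : ℝ) :
    ‖p.avg f z‖ ≤ C := by
  have := norm_integral_le_of_norm_le_const (μ := expMeasure p.lam₁)
    (f := fun x => f (z + x)) (ae_of_all _ fun x => hC _)
  rw [probReal_univ, mul_one] at this
  exact this

lemma norm_op_le {f : ℝ → E} {C : ℝ} (hC : ∀ x, ‖f x‖ ≤ C) (z : ℝ) :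
    ‖p.op s f z‖ ≤ C := by
  have h0 := p.expAck_nonneg s
  have h1 := p.expAck_lt_one s
  unfold op
  split_ifs
  · refine (norm_add_le _ _).trans ?_
    rw [norm_smul, norm_smul, Real.norm_of_nonneg h0, Real.norm_of_nonneg (by linarith)]
    have h2 := p.norm_avg_le hC (z - p.M)
    have h3 := p.norm_avg_le hC z
    nlinarith
  · exact p.norm_avg_le hC z

/-- The ACK event and the harvested energy are independent, so integrating out the SNR only weights
the two possible moves by q and 1 - q. Values in `E` serve both real indicators (convergence) and
complex characters (stationarity). -/
lemma integral_slotLaw_bufferStep {f : ℝ → E} (hf : StronglyMeasurable f) {C : ℝ}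
    (hC : ∀ x, ‖f x‖ ≤ C) [CompleteSpace E] (b : ℝ) :
    ∫ z, f (p.bufferStep s b z.2.2.2 (p.snrFromSource z.2.2.1)) ∂p.slotLaw = p.op s f b := by
  have hg : StronglyMeasurable fun y : ℝ × ℝ => f (p.bufferStep s b y.2 y.1) :=
    hf.comp_measurable ((p.measurable_bufferStep s).comp
      (g := fun y : ℝ × ℝ × ℝ => p.bufferStep s y.1 y.2.1 y.2.2)
      (f := fun y : ℝ × ℝ => (b, y.2, y.1)) (by fun_prop))
  have hm : Measurable fun z : ℂ × ℂ × ℂ × ℝ => (p.snrFromSource z.2.2.1, z.2.2.2) := by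
    have := p.measurable_snrFromSource
    fun_prop
  rw [← integral_map (φ := fun z : ℂ × ℂ × ℂ × ℝ => (p.snrFromSource z.2.2.1, z.2.2.2))
    (f := fun y : ℝ × ℝ => f (p.bufferStep s b y.2 y.1)) hm.aemeasurable
    hg.aestronglyMeasurable, p.map_snrSD_energy,
    integral_prod _ (integrable_of_norm_le hg fun x => hC _)]
  have hin : ∀ γ : ℝ, ∫ x, f (p.bufferStep s b x γ) ∂expMeasure p.lam₁
      = {γ : ℝ | p.ackThreshold s ≤ (γ : EReal)}.indicator (fun _ => p.avg f b) γ
        + {γ : ℝ | p.ackThreshold s ≤ (γ : EReal)}ᶜ.indicator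
          (fun _ => if p.M ≤ b then p.avg f (b - p.M) else p.avg f b) γ := by
    intro γ
    unfold bufferStep avg
    by_cases h : p.ackThreshold s ≤ (γ : EReal)
    · simp [h]
    · by_cases hb : p.M ≤ b <;> simp [h, hb]
  simp_rw [hin]
  have hA := p.measurableSet_ack s
  rw [integral_add ((integrable_const _).indicator hA) ((integrable_const _).indicator hA.compl),
    integral_indicator_const _ hA, integral_indicator_const _ hA.compl, p.expMeasure_ack,
    probReal_compl_eq_one_sub hA, p.expMeasure_ack]
  unfold op
  split_ifs
  · rw [add_comm]
  · rw [← add_smul]; simp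

lemma integral_nextLaw {f : ℝ → E} (hf : StronglyMeasurable f) {C : ℝ}
    (hC : ∀ x, ‖f x‖ ≤ C) [CompleteSpace E] (μ : Measure ℝ) [IsProbabilityMeasure μ] :
    ∫ b, f b ∂p.nextLaw s μ = ∫ b, p.op s f b ∂μ := by
  have hm := p.measurable_nextLaw_map s
  unfold nextLaw
  rw [integral_map hm.aemeasurable hf.aestronglyMeasurable,
    integral_prod (fun z : ℝ × ℂ × ℂ × ℂ × ℝ =>
      f (p.bufferStep s z.1 z.2.2.2.2 (p.snrFromSource z.2.2.2.1)))
      (integrable_of_norm_le (hf.comp_measurable hm) fun x => hC _)]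
  exact integral_congr_ae (ae_of_all _ fun b => p.integral_slotLaw_bufferStep s hf hC b)

lemma iterate_op_bounded {f : ℝ → E} (hf : StronglyMeasurable f) {C : ℝ}
    (hC : ∀ x, ‖f x‖ ≤ C) (n : ℕ) :
    StronglyMeasurable ((p.op s)^[n] f) ∧ ∀ x, ‖(p.op s)^[n] f x‖ ≤ C := by
  induction n with
  | zero => exact ⟨hf, hC⟩
  | succ n ih =>
    rw [Function.iterate_succ_apply']
    exact ⟨p.stronglyMeasurable_op s ih.1, p.norm_op_le s ih.2⟩

lemma integral_iterate_nextLaw {f : ℝ → E} (hf : StronglyMeasurable f) {C : ℝ}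
    (hC : ∀ x, ‖f x‖ ≤ C) [CompleteSpace E] (μ : Measure ℝ) [IsProbabilityMeasure μ] (n : ℕ) :
    ∫ b, f b ∂(p.nextLaw s)^[n] μ = ∫ b, (p.op s)^[n] f b ∂μ := by
  induction n generalizing f μ with
  | zero => rfl
  | succ n ih =>
    rw [Function.iterate_succ_apply, ih hf hC, Function.iterate_succ_apply']
    have h := p.iterate_op_bounded s hf hC n
    exact p.integral_nextLaw s h.1 h.2 μ

end Params

/-! ### Stable case: drift, minorization and loss of memory -/

namespace Params

variable (p : Params) (s : Signalling)

lemma avg_sub_const {f : ℝ → ℝ} (hf : StronglyMeasurable f) {C : ℝ} (hC : ∀ x, ‖f x‖ ≤ C)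
    (c z : ℝ) : ∫ x, (f (z + x) - c) ∂expMeasure p.lam₁ = p.avg f z - c := by
  have hi : Integrable (fun x => f (z + x)) (expMeasure p.lam₁) :=
    integrable_of_norm_le (hf.comp_measurable (measurable_const_add z)) fun x => hC _
  rw [integral_sub hi (integrable_const c)]
  simp [avg]

lemma integrable_lyapunov {θ : ℝ} (hθ : θ < p.lam₁) (A β z : ℝ) :
    Integrable (fun x => A * (1 + β * Real.exp (θ * (z + x)))) (expMeasure p.lam₁) := by
  have h := (((integrable_const (1 : ℝ)).add ((integrable_exp_mul_expMeasure p.lam₁_pos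
    hθ).const_mul (β * Real.exp (θ * z)))).const_mul A)
  refine h.congr (ae_of_all _ fun x => ?_)
  simp only [Pi.add_apply]
  rw [mul_add θ, Real.exp_add]
  ring

lemma integral_lyapunov {θ : ℝ} (hθ : θ < p.lam₁) (A β z : ℝ) :
    ∫ x, A * (1 + β * Real.exp (θ * (z + x))) ∂expMeasure p.lam₁
      = A * (1 + β * (p.lam₁ / (p.lam₁ - θ) * Real.exp (θ * z))) := by
  have h : ∀ x, A * (1 + β * Real.exp (θ * (z + x)))
      = A * (1 + (β * Real.exp (θ * z)) * Real.exp (θ * x)) := by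
    intro x; rw [mul_add θ, Real.exp_add]; ring
  simp_rw [h]
  rw [integral_const_mul, integral_add (integrable_const _)
    ((integrable_exp_mul_expMeasure p.lam₁_pos hθ).const_mul _), integral_const_mul,
    integral_exp_mul_expMeasure p.lam₁_pos hθ]
  simp
  ring_nf
  simp

section Lyapunov

variable {f : ℝ → ℝ} {C c A β θ : ℝ}

lemma abs_avg_sub_le (hf : StronglyMeasurable f) (hC : ∀ x, ‖f x‖ ≤ C) (hθ : θ < p.lam₁)
    (h : ∀ x, 0 ≤ x → |f x - c| ≤ A * (1 + β * Real.exp (θ * x))) {z : ℝ} (hz : 0 ≤ z) :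
    |p.avg f z - c| ≤ A * (1 + β * (p.lam₁ / (p.lam₁ - θ) * Real.exp (θ * z))) := by
  rw [← p.avg_sub_const hf hC, ← p.integral_lyapunov hθ, ← Real.norm_eq_abs]
  refine norm_integral_le_of_norm_le (p.integrable_lyapunov hθ A β z) ?_
  filter_upwards [ae_nonneg_expMeasure p.lam₁_pos] with x hx
  exact h (z + x) (by linarith)

/-- Minorization: after one jump the chain started below `K` coincides with the chain started at
`K` with probability at least `exp (-lam₁ K)`. -/
lemma abs_avg_sub_le_of_le (hf : StronglyMeasurable f) (hC : ∀ x, ‖f x‖ ≤ C) (hθ : θ < p.lam₁)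
    (hA : 0 ≤ A) (hβ : 0 ≤ β)
    (h : ∀ x, 0 ≤ x → |f x - c| ≤ A * (1 + β * Real.exp (θ * x))) {z K : ℝ} (hz : 0 ≤ z)
    (hzK : z ≤ K) :
    |p.avg f z - (Real.exp (-(p.lam₁ * K)) * p.avg f K + (1 - Real.exp (-(p.lam₁ * K))) * c)|
      ≤ A * (1 - Real.exp (-(p.lam₁ * K))
        + β * (p.lam₁ / (p.lam₁ - θ) * Real.exp (θ * z))) := by
  have hlam := p.lam₁_pos
  have ha : 0 ≤ K - z := by linarith
  have hi : Integrable (fun x => f (z + x) - c) (expMeasure p.lam₁) :=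
    (integrable_of_norm_le (hf.comp_measurable (measurable_const_add z)) fun x => hC _).sub
      (integrable_const c)
  have hV := p.integrable_lyapunov hθ A β z
  -- Split at the jump that first reaches K. By memorylessness the overshooting part has the law of
  -- a chain jumping from K; e2 is the same split for the Lyapunov bound.
  have e1 : p.avg f z - c = (∫ x in Iio (K - z), (f (z + x) - c) ∂expMeasure p.lam₁)
      + Real.exp (-(p.lam₁ * (K - z))) * (p.avg f K - c) := by
    rw [← p.avg_sub_const hf hC, ← integral_add_compl (measurableSet_Iio (a := K - z)) hi,
      compl_Iio, setIntegral_expMeasure_Ici hlam ha, ← p.avg_sub_const hf hC, smul_eq_mul]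
    congr 4
    ext x
    congr 2
    ring
  have e2 : A * (1 + β * (p.lam₁ / (p.lam₁ - θ) * Real.exp (θ * z)))
      = (∫ x in Iio (K - z), A * (1 + β * Real.exp (θ * (z + x))) ∂expMeasure p.lam₁)
      + Real.exp (-(p.lam₁ * (K - z)))
        * (A * (1 + β * (p.lam₁ / (p.lam₁ - θ) * Real.exp (θ * K)))) := by
    rw [← p.integral_lyapunov hθ, ← integral_add_compl (measurableSet_Iio (a := K - z)) hV,
      compl_Iio, setIntegral_expMeasure_Ici hlam ha, ← p.integral_lyapunov hθ, smul_eq_mul]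
    congr 4
    ext x
    congr 5
    ring
  have b1 : |∫ x in Iio (K - z), (f (z + x) - c) ∂expMeasure p.lam₁|
      ≤ ∫ x in Iio (K - z), A * (1 + β * Real.exp (θ * (z + x))) ∂expMeasure p.lam₁ := by
    rw [← Real.norm_eq_abs]
    refine norm_integral_le_of_norm_le hV.integrableOn ?_
    filter_upwards [ae_restrict_of_ae (ae_nonneg_expMeasure hlam)] with x hx
    exact h (z + x) (by linarith)
  have b2 := p.abs_avg_sub_le hf hC hθ h (hz.trans hzK)
  have hε : Real.exp (-(p.lam₁ * K)) ≤ Real.exp (-(p.lam₁ * (K - z))) := by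
    apply Real.exp_le_exp.2; nlinarith
  have hε0 := Real.exp_pos (-(p.lam₁ * K))
  set ε := Real.exp (-(p.lam₁ * K))
  set δ := Real.exp (-(p.lam₁ * (K - z)))
  set I := ∫ x in Iio (K - z), (f (z + x) - c) ∂expMeasure p.lam₁
  -- Only mass ε of the overshooting mass δ is matched, because ε does not depend on z; the constant
  -- subtracted is then common to all z ≤ K. The leftover δ - ε is estimated crudely.
  have e3 : p.avg f z - (ε * p.avg f K + (1 - ε) * c) = I + (δ - ε) * (p.avg f K - c) := by
    linear_combination e1
  rw [e3]
  refine (abs_add_le _ _).trans ?_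
  rw [abs_mul, abs_of_nonneg (sub_nonneg.2 hε)]
  have b3 := mul_le_mul_of_nonneg_left b2 (sub_nonneg.2 hε)
  have hl : 0 < p.lam₁ / (p.lam₁ - θ) := div_pos hlam (sub_pos.2 hθ)
  have b4 : 0 ≤ ε * (A * (β * (p.lam₁ / (p.lam₁ - θ) * Real.exp (θ * K)))) := by positivity
  nlinarith

/-- Growth factor of the Lyapunov function `exp (θ b)` above the level `M`. -/
noncomputable def growth (θ : ℝ) : ℝ :=
  p.lam₁ / (p.lam₁ - θ) * ((1 - p.expAck s) * Real.exp (-(θ * p.M)) + p.expAck s)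

/-- Above `M` the operator is a convex combination of two averages, and `growth` collects their
weights. The constant `a` is 1 where only drift is used and 1 - ε where minorization is available.
-/
lemma abs_op_sub_le_of_avg (g : ℝ → ℝ) (d a : ℝ) {b : ℝ} (hb : p.M ≤ b)
    (h1 : |p.avg g (b - p.M) - d|
      ≤ A * (a + β * (p.lam₁ / (p.lam₁ - θ) * Real.exp (θ * (b - p.M)))))
    (h2 : |p.avg g b - d| ≤ A * (a + β * (p.lam₁ / (p.lam₁ - θ) * Real.exp (θ * b)))) :
    |p.op s g b - d| ≤ A * (a + β * (p.growth s θ * Real.exp (θ * b))) := by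
  have h0 := p.expAck_nonneg s
  have h3 : 0 ≤ 1 - p.expAck s := sub_nonneg.2 (p.expAck_lt_one s).le
  have e1 : p.op s g b - d = (1 - p.expAck s) * (p.avg g (b - p.M) - d)
      + p.expAck s * (p.avg g b - d) := by
    unfold op
    rw [if_pos hb, smul_eq_mul, smul_eq_mul]
    ring
  have e2 : Real.exp (θ * (b - p.M)) = Real.exp (-(θ * p.M)) * Real.exp (θ * b) := by
    rw [← Real.exp_add]; ring_nf
  rw [e1]
  refine (abs_add_le _ _).trans ?_
  rw [abs_mul, abs_mul, abs_of_nonneg h0, abs_of_nonneg h3]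
  refine (add_le_add (mul_le_mul_of_nonneg_left h1 h3)
    (mul_le_mul_of_nonneg_left h2 h0)).trans_eq ?_
  rw [e2]
  unfold growth
  ring

/-- Harris contraction of the buffer chain with the Lyapunov function `exp (θ b)`. -/
lemma exists_contraction (hθ0 : 0 < θ) (hθ : θ < p.lam₁) (hγ : p.growth s θ < 1) :
    ∃ β a : ℝ, 0 < β ∧ 0 ≤ a ∧ a < 1 ∧ ∀ (f : ℝ → ℝ) (C A c : ℝ), StronglyMeasurable f →
      (∀ x, ‖f x‖ ≤ C) → 0 ≤ A →
      (∀ x, 0 ≤ x → |f x - c| ≤ A * (1 + β * Real.exp (θ * x))) →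
      ∃ c', ∀ x, 0 ≤ x → |p.op s f x - c'| ≤ (a * A) * (1 + β * Real.exp (θ * x)) := by
  have hlam := p.lam₁_pos
  have hl : 0 < p.lam₁ / (p.lam₁ - θ) := div_pos hlam (sub_pos.2 hθ)
  have hγ0 : 0 ≤ p.growth s θ := by
    have := p.expAck_nonneg s
    have h3 : 0 ≤ 1 - p.expAck s := sub_nonneg.2 (p.expAck_lt_one s).le
    unfold growth; positivity
  have hop := fun (f : ℝ → ℝ) (d a A β : ℝ) {b : ℝ} =>
    p.abs_op_sub_le_of_avg s (A := A) (β := β) (θ := θ) f d a (b := b)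
  generalize p.growth s θ = γ at hγ hγ0 hop
  have havg := fun (f : ℝ → ℝ) (C c A β : ℝ) =>
    p.abs_avg_sub_le (f := f) (C := C) (c := c) (A := A) (β := β) (θ := θ)
  have havg' := fun (f : ℝ → ℝ) (C c A β : ℝ) =>
    p.abs_avg_sub_le_of_le (f := f) (C := C) (c := c) (A := A) (β := β) (θ := θ)
  generalize p.lam₁ / (p.lam₁ - θ) = l at hl hop havg havg'
  set D := l * Real.exp (θ * p.M) with hD
  have hD0 : 0 < D := by positivity
  have t1 : Tendsto (fun K : ℝ => Real.exp (θ * K)) atTop atTop :=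
    Real.tendsto_exp_atTop.comp (tendsto_id.const_mul_atTop hθ0)
  have t2 : Tendsto (fun K : ℝ => Real.exp (-(p.lam₁ * K))) atTop (𝓝 0) :=
    Real.tendsto_exp_neg_atTop_nhds_zero.comp (tendsto_id.const_mul_atTop hlam)
  have hγ1 : 0 < 1 - γ := sub_pos.2 hγ
  -- Beyond K, passing from c to the new constant costs ε + ε l β exp (θ K). With β as below, the
  -- two conditions bound each summand by (1 - γ) β exp (θ K) / 4, so the total is at most half of
  -- the drift gain.
  obtain ⟨K, hKM, hK1, hK2⟩ : ∃ K, p.M ≤ K ∧ 8 * D / (1 - γ) ≤ Real.exp (θ * K) ∧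
      Real.exp (-(p.lam₁ * K)) < (1 - γ) / 4 / l :=
    ((eventually_ge_atTop p.M).and ((t1.eventually_ge_atTop _).and
      (t2.eventually_lt_const (by positivity)))).exists
  have hK0 : 0 ≤ K := p.M_pos.le.trans hKM
  have hε1 : Real.exp (-(p.lam₁ * K)) ≤ 1 := Real.exp_le_one_iff.2 (by nlinarith)
  have hε0 := Real.exp_pos (-(p.lam₁ * K))
  rw [lt_div_iff₀ hl] at hK2
  rw [div_le_iff₀ hγ1] at hK1
  set ε := Real.exp (-(p.lam₁ * K)) with hε
  -- Below `M` nothing is consumed and the Lyapunov term may grow, to at most β D. This choice makes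
  -- it ε / 2, half of the minorization gain.
  set β := ε / (2 * D) with hβ
  have hβ0 : 0 < β := by positivity
  have hβD : β * D = ε / 2 := by rw [hβ]; field_simp
  have hVK := Real.exp_pos (θ * K)
  set VK := Real.exp (θ * K) with hVKdef
  set g := (1 + γ) / 2 with hg
  -- The entries cover b < M, M ≤ b ≤ K and b > K. The last is (1 + g v) / (1 + v) at v = β exp (θ
  -- K), its largest value for v ≥ β exp (θ K), since g < 1.
  set a := max (1 - ε / 2) (max γ ((1 + g * (β * VK)) / (1 + β * VK))) with ha
  have hs : 0 < β * VK := by positivity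
  have ha1 : 1 - ε / 2 ≤ a := le_max_left _ _
  have ha2 : γ ≤ a := (le_max_left _ _).trans (le_max_right _ _)
  have ha3 : 1 + g * (β * VK) ≤ a * (1 + β * VK) := by
    rw [← div_le_iff₀ (by positivity)]
    exact (le_max_right _ _).trans (le_max_right _ _)
  have ha4 : g ≤ a := by
    refine le_trans ?_ ((le_max_right _ _).trans (le_max_right _ _))
    rw [le_div_iff₀ (by positivity)]
    nlinarith
  have hlt : a < 1 := by
    refine max_lt (by linarith) (max_lt hγ ?_)
    rw [div_lt_one (by positivity)]
    nlinarith
  have ha0 : 0 ≤ a := hγ0.trans ha2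
  refine ⟨β, a, hβ0, ha0, hlt, fun f C A c hf hC hA hfc => ?_⟩
  -- The value carried by the component common to all starting points up to K, completed by the old
  -- constant.
  refine ⟨ε * p.avg f K + (1 - ε) * c, fun b hb => ?_⟩
  have hVb := Real.exp_pos (θ * b)
  rcases le_or_gt b K with hbK | hbK
  · rcases le_or_gt p.M b with hbM | hbM
    · refine (hop f _ (1 - ε) A β hbM
        (havg' f C c A β hf hC hθ hA hβ0.le hfc (sub_nonneg.2 hbM)
          (by linarith [p.M_pos]))
        (havg' f C c A β hf hC hθ hA hβ0.le hfc hb hbK)).trans ?_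
      have h1 : β * (γ * Real.exp (θ * b)) ≤ a * (β * Real.exp (θ * b)) := by
        have := mul_le_mul_of_nonneg_right ha2 (mul_pos hβ0 hVb).le
        linarith
      have h2 : 1 - ε + β * (γ * Real.exp (θ * b)) ≤ a * (1 + β * Real.exp (θ * b)) := by
        linarith
      have := mul_le_mul_of_nonneg_left h2 hA
      linarith
    · have e : p.op s f b = p.avg f b := by
        unfold op; rw [if_neg (not_le.2 hbM)]
      rw [e]
      refine (havg' f C c A β hf hC hθ hA hβ0.le hfc hb hbK).trans ?_
      have h1 : l * Real.exp (θ * b) ≤ D := by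
        rw [hD]
        have : Real.exp (θ * b) ≤ Real.exp (θ * p.M) := by
          apply Real.exp_le_exp.2; nlinarith
        exact mul_le_mul_of_nonneg_left this hl.le
      have h2 := mul_le_mul_of_nonneg_left h1 hβ0.le
      have h3 : 1 - ε + β * (l * Real.exp (θ * b)) ≤ a * (1 + β * Real.exp (θ * b)) := by
        have : 0 ≤ a * (β * Real.exp (θ * b)) := by positivity
        linarith
      have := mul_le_mul_of_nonneg_left h3 hA
      linarith
  · have hbM : p.M ≤ b := hKM.trans hbK.le
    have h1 := hop f c 1 A β hbM (havg f C c A β hf hC hθ hfc (sub_nonneg.2 hbM))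
      (havg f C c A β hf hC hθ hfc hb)
    have h2 := mul_le_mul_of_nonneg_left (havg f C c A β hf hC hθ hfc hK0) hε0.le
    have e : p.op s f b - (ε * p.avg f K + (1 - ε) * c)
        = (p.op s f b - c) - ε * (p.avg f K - c) := by ring
    rw [e]
    refine (abs_sub _ _).trans ?_
    rw [abs_mul, abs_of_pos hε0]
    refine (add_le_add h1 h2).trans ?_
    have hV : VK ≤ Real.exp (θ * b) := by
      rw [hVKdef]; apply Real.exp_le_exp.2; nlinarith
    have h3 : ε ≤ β * ((1 - γ) * VK) / 4 := by nlinarith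
    have h4 : β * VK * (ε * l) ≤ β * VK * ((1 - γ) / 4) :=
      mul_le_mul_of_nonneg_left hK2.le hs.le
    have h5 : β * VK ≤ β * Real.exp (θ * b) := mul_le_mul_of_nonneg_left hV hβ0.le
    set v := β * Real.exp (θ * b) with hv
    have h6 : 1 + g * v ≤ a * (1 + v) := by nlinarith
    have h7 : (1 + γ * v) + (ε + ε * l * (β * VK)) ≤ a * (1 + v) := by
      refine le_trans ?_ h6
      have : (1 - γ) * (β * VK) ≤ (1 - γ) * v := mul_le_mul_of_nonneg_left h5 hγ1.le
      rw [hg]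
      linarith
    have := mul_le_mul_of_nonneg_left h7 hA
    rw [hv] at this ⊢
    linarith

end Lyapunov

/-- The last inequality is `growth` < 1 with denominators cleared. Its right side has slope `phi` >
1 at θ = 0, so it holds for small θ; quantitatively, 1 - exp (-u) ≥ u / (1 + u), and θ M < `phi` - 1
suffices. -/
lemma exists_growth_lt_one (h : 1 < p.phi s) :
    ∃ θ, 0 < θ ∧ θ < p.lam₁ ∧ θ < p.lam₁ * (1 - p.expAck s) * (1 - Real.exp (-(θ * p.M))) := by
  have hlam := p.lam₁_pos
  have hM := p.M_pos
  have hphi : 0 < (p.phi s - 1) / p.M := div_pos (by linarith) hM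
  refine ⟨min p.lam₁ ((p.phi s - 1) / p.M) / 2, by positivity, ?_, ?_⟩
  · have := min_le_left p.lam₁ ((p.phi s - 1) / p.M); linarith
  · have h1 : min p.lam₁ ((p.phi s - 1) / p.M) / 2 < (p.phi s - 1) / p.M := by
      have := min_le_right p.lam₁ ((p.phi s - 1) / p.M); linarith
    have h0 : 0 < min p.lam₁ ((p.phi s - 1) / p.M) / 2 := by positivity
    set θ := min p.lam₁ ((p.phi s - 1) / p.M) / 2
    rw [lt_div_iff₀ hM] at h1
    have hq : 0 < 1 - p.expAck s := sub_pos.2 (p.expAck_lt_one s)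
    have h2 : Real.exp (-(θ * p.M)) ≤ 1 / (1 + θ * p.M) := by
      rw [Real.exp_neg, ← one_div]
      exact one_div_le_one_div_of_le (by positivity) (by linarith [Real.add_one_le_exp (θ * p.M)])
    have h3 : θ * p.M / (1 + θ * p.M) ≤ 1 - Real.exp (-(θ * p.M)) := by
      have : θ * p.M / (1 + θ * p.M) = 1 - 1 / (1 + θ * p.M) := by field_simp; ring
      linarith
    refine lt_of_lt_of_le ?_ (mul_le_mul_of_nonneg_left h3 (by positivity))
    have e : p.lam₁ * (1 - p.expAck s) * (θ * p.M / (1 + θ * p.M))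
        = θ * (p.phi s / (1 + θ * p.M)) := by unfold phi; field_simp
    rw [e]
    have : 1 < p.phi s / (1 + θ * p.M) := by
      rw [one_lt_div (by positivity)]; linarith
    nlinarith

/-- In the stable case the chain forgets its initial level. -/
lemma tendsto_iterate_op_sub (h : 1 < p.phi s) {f : ℝ → ℝ} (hf : StronglyMeasurable f)
    (h1 : ∀ x, ‖f x‖ ≤ 1) {x : ℝ} (hx : 0 ≤ x) :
    Tendsto (fun n => (p.op s)^[n] f x - (p.op s)^[n] f 0) atTop (𝓝 0) := by
  obtain ⟨θ, hθ0, hθ, hθ'⟩ := p.exists_growth_lt_one s h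
  have hγ : p.growth s θ < 1 := by
    unfold growth
    rw [div_mul_eq_mul_div, div_lt_one (by linarith)]
    nlinarith
  obtain ⟨β, a, hβ, ha0, ha, H⟩ := p.exists_contraction s hθ0 hθ hγ
  -- The centring constant changes with n and is not controlled; it cancels when two starting points
  -- are compared.
  have key : ∀ n, ∃ c, ∀ x, 0 ≤ x →
      |(p.op s)^[n] f x - c| ≤ a ^ n * (1 + β * Real.exp (θ * x)) := by
    intro n
    induction n with
    | zero =>
      refine ⟨0, fun x _ => ?_⟩
      have := h1 x
      have h2 : 0 ≤ β * Real.exp (θ * x) := by positivity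
      rw [Real.norm_eq_abs] at this
      simp only [Function.iterate_zero, id, sub_zero, pow_zero, one_mul]
      linarith
    | succ n ih =>
      obtain ⟨c, hc⟩ := ih
      have hb := p.iterate_op_bounded s hf h1 n
      obtain ⟨c', hc'⟩ := H _ 1 (a ^ n) c hb.1 hb.2 (by positivity) hc
      refine ⟨c', fun x hx => ?_⟩
      rw [Function.iterate_succ_apply', pow_succ']
      exact hc' x hx
  have hlim : Tendsto (fun n : ℕ => a ^ n * ((1 + β * Real.exp (θ * x))
      + (1 + β * Real.exp (θ * 0)))) atTop (𝓝 0) := by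
    simpa using (tendsto_pow_atTop_nhds_zero_of_lt_one ha0 ha).mul_const
      ((1 + β * Real.exp (θ * x)) + (1 + β * Real.exp (θ * 0)))
  refine squeeze_zero_norm (fun n => ?_) hlim
  obtain ⟨c, hc⟩ := key n
  have e : (p.op s)^[n] f x - (p.op s)^[n] f 0
      = ((p.op s)^[n] f x - c) - ((p.op s)^[n] f 0 - c) := by ring
  rw [e, Real.norm_eq_abs, mul_add]
  exact (abs_sub _ _).trans (add_le_add (hc x hx) (hc 0 le_rfl))

lemma tendsto_integral_iterate_op_sub (h : 1 < p.phi s) {f : ℝ → ℝ} (hf : StronglyMeasurable f)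
    (h1 : ∀ x, ‖f x‖ ≤ 1) (μ : Measure ℝ) [IsProbabilityMeasure μ] (hμ : ∀ᵐ b ∂μ, 0 ≤ b) :
    Tendsto (fun n => ∫ b, f b ∂(p.nextLaw s)^[n] μ - (p.op s)^[n] f 0) atTop (𝓝 0) := by
  have hb := fun n => p.iterate_op_bounded s hf h1 n
  have key : Tendsto (fun n => ∫ b, ((p.op s)^[n] f b - (p.op s)^[n] f 0) ∂μ) atTop
      (𝓝 (∫ _, (0 : ℝ) ∂μ)) := by
    refine tendsto_integral_of_dominated_convergence (fun _ => 2)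
      (fun n => ((hb n).1.sub stronglyMeasurable_const).aestronglyMeasurable)
      (integrable_const _) (fun n => ae_of_all _ fun b => ?_) ?_
    · refine (norm_sub_le _ _).trans ?_
      have h2 := (hb n).2 b
      have h3 := (hb n).2 0
      linarith
    · filter_upwards [hμ] with b hb
      exact p.tendsto_iterate_op_sub s h hf h1 hb
  rw [integral_zero] at key
  refine key.congr fun n => ?_
  rw [p.integral_iterate_nextLaw s hf h1, integral_sub
    (integrable_of_norm_le (hb n).1 (hb n).2) (integrable_const _)]
  simp

/-- In the stable case the laws of two chains merge on every event. -/
lemma tendsto_iterate_nextLaw_sub (h : 1 < p.phi s) {S : Set ℝ} (hS : MeasurableSet S)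
    (μ ν : Measure ℝ) [IsProbabilityMeasure μ] [IsProbabilityMeasure ν] (hμ : ∀ᵐ b ∂μ, 0 ≤ b)
    (hν : ∀ᵐ b ∂ν, 0 ≤ b) :
    Tendsto (fun n => ((p.nextLaw s)^[n] μ).real S - ((p.nextLaw s)^[n] ν).real S) atTop
      (𝓝 0) := by
  have hf : StronglyMeasurable (S.indicator (1 : ℝ → ℝ)) :=
    stronglyMeasurable_one.indicator hS
  have h1 : ∀ x, ‖S.indicator (1 : ℝ → ℝ) x‖ ≤ 1 := fun x => by
    by_cases hx : x ∈ S <;> simp [hx]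
  have := (p.tendsto_integral_iterate_op_sub s h hf h1 μ hμ).sub
    (p.tendsto_integral_iterate_op_sub s h hf h1 ν hν)
  rw [sub_zero] at this
  refine this.congr fun n => ?_
  rw [integral_indicator_one hS, integral_indicator_one hS]
  ring

lemma isStationaryLaw_iterate {π : Measure ℝ} (h : p.IsStationaryLaw s π) (n : ℕ) :
    (p.nextLaw s)^[n] π = π :=
  Function.iterate_fixed h.invariant n

lemma isStationaryLaw_unique (h : 1 < p.phi s) {π ν : Measure ℝ} (hπ : p.IsStationaryLaw s π)
    (hν : p.IsStationaryLaw s ν) : π = ν := by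
  have := hπ.isProb
  have := hν.isProb
  ext S hS
  have key := p.tendsto_iterate_nextLaw_sub s h hS π ν hπ.nonneg hν.nonneg
  simp_rw [p.isStationaryLaw_iterate s hπ, p.isStationaryLaw_iterate s hν] at key
  have h0 := tendsto_nhds_unique key tendsto_const_nhds
  exact (measureReal_eq_measureReal_iff).1 (sub_eq_zero.1 h0.symm)

end Params

/-! ### Stable case: the explicit stationary law -/

/-- The uniform law on `(0, M]`. -/
noncomputable def uniformLaw (M : ℝ) : Measure ℝ :=
  ENNReal.ofReal (1 / M) • volume.restrict (Ioc 0 M)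

/-- The law of the sum of a uniform variable on `(0, M]` and an independent exponential variable
of rate `r`. -/
noncomputable def uniformAddExp (M r : ℝ) : Measure ℝ :=
  ((uniformLaw M).prod (expMeasure r)).map (fun z => z.1 + z.2)

lemma isProbabilityMeasure_uniformLaw {M : ℝ} (hM : 0 < M) :
    IsProbabilityMeasure (uniformLaw M) := by
  refine ⟨?_⟩
  simp only [uniformLaw, Measure.smul_apply, MeasurableSet.univ, Measure.restrict_apply,
    univ_inter, Real.volume_Ioc, sub_zero, smul_eq_mul]
  rw [← ENNReal.ofReal_mul (by positivity), one_div_mul_cancel hM.ne', ENNReal.ofReal_one]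

lemma integral_uniformLaw {E : Type*} [NormedAddCommGroup E] [NormedSpace ℝ E] {M : ℝ}
    (hM : 0 < M) (f : ℝ → E) : ∫ u, f u ∂uniformLaw M = (1 / M) • ∫ u in (0)..M, f u := by
  rw [uniformLaw, integral_smul_measure, ENNReal.toReal_ofReal (by positivity),
    intervalIntegral.integral_of_le hM.le]

lemma ae_mem_uniformLaw (M : ℝ) : ∀ᵐ u ∂uniformLaw M, u ∈ Ioc 0 M :=
  Measure.ae_smul_measure (ae_restrict_mem measurableSet_Ioc) _

section UniformAddExp

variable {M r : ℝ} {E : Type*} [NormedAddCommGroup E] [NormedSpace ℝ E]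

lemma isProbabilityMeasure_uniformAddExp (hM : 0 < M) (hr : 0 < r) :
    IsProbabilityMeasure (uniformAddExp M r) := by
  have := isProbabilityMeasure_expMeasure hr
  have := isProbabilityMeasure_uniformLaw hM
  exact Measure.isProbabilityMeasure_map (by fun_prop)

lemma ae_nonneg_uniformAddExp (hM : 0 < M) (hr : 0 < r) :
    ∀ᵐ b ∂uniformAddExp M r, 0 ≤ b := by
  have := isProbabilityMeasure_expMeasure hr
  have := isProbabilityMeasure_uniformLaw hM
  unfold uniformAddExp
  rw [ae_map_iff (by fun_prop) measurableSet_Ici]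
  filter_upwards [Measure.quasiMeasurePreserving_fst.ae (ae_mem_uniformLaw M),
    Measure.quasiMeasurePreserving_snd.ae (ae_nonneg_expMeasure hr)] with z h1 h2
  exact add_nonneg h1.1.le h2

lemma integral_uniformAddExp (hM : 0 < M) (hr : 0 < r) {f : ℝ → E} (hf : StronglyMeasurable f)
    {C : ℝ} (hC : ∀ x, ‖f x‖ ≤ C) :
    ∫ b, f b ∂uniformAddExp M r = ∫ u, ∫ x, f (u + x) ∂expMeasure r ∂uniformLaw M := by
  have := isProbabilityMeasure_expMeasure hr
  have := isProbabilityMeasure_uniformLaw hM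
  unfold uniformAddExp
  rw [integral_map (by fun_prop) hf.aestronglyMeasurable]
  exact integral_prod (fun z : ℝ × ℝ => f (z.1 + z.2))
    (integrable_of_norm_le (hf.comp_measurable (by fun_prop)) fun x => hC _)

/-- This is the probability that uniform plus exponential reaches `M`: given u, the exponential must
exceed M - u. -/
lemma integral_uniformLaw_exp (hM : 0 < M) (hr : 0 < r) :
    ∫ u, Real.exp (-(r * (M - u))) ∂uniformLaw M = (1 - Real.exp (-(r * M))) / (r * M) := by
  rw [integral_uniformLaw hM]
  have h : ∀ u, Real.exp (-(r * (M - u))) = Real.exp (-(r * M)) * Real.exp (r * u) := by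
    intro u; rw [← Real.exp_add]; ring_nf
  have h2 : Real.exp (-(r * M)) * Real.exp (r * M) = 1 := by rw [← Real.exp_add]; simp
  simp_rw [h]
  rw [intervalIntegral.integral_const_mul, intervalIntegral.integral_comp_mul_left
    (fun x => Real.exp x) hr.ne', integral_exp]
  simp only [smul_eq_mul, mul_zero, Real.exp_zero]
  rw [one_div, div_eq_inv_mul, mul_inv]
  linear_combination (M⁻¹ * r⁻¹) * h2

/-- Above the level `M` the law is that of an exponential variable shifted by `M`. -/
lemma setIntegral_uniformAddExp (hM : 0 < M) (hr : 0 < r) [CompleteSpace E] {f : ℝ → E}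
    (hf : StronglyMeasurable f) {C : ℝ} (hC : ∀ x, ‖f x‖ ≤ C) :
    ∫ b in Ici M, f b ∂uniformAddExp M r
      = ((1 - Real.exp (-(r * M))) / (r * M)) • ∫ x, f (M + x) ∂expMeasure r := by
  rw [← integral_indicator measurableSet_Ici, integral_uniformAddExp hM hr
    (hf.indicator measurableSet_Ici) (C := C)
    (fun x => (norm_indicator_le_norm_self f x).trans (hC x)),
    ← integral_uniformLaw_exp hM hr, ← integral_smul_const]
  refine integral_congr_ae ?_
  filter_upwards [ae_mem_uniformLaw M] with u hu
  have h : ∀ x, (Ici M).indicator f (u + x)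
      = (Ici (M - u)).indicator (fun x => f (u + x)) x := by
    intro x
    by_cases hx : M - u ≤ x
    · rw [indicator_of_mem (by simpa using by linarith), indicator_of_mem (by exact hx)]
    · rw [indicator_of_notMem (by simpa using by linarith), indicator_of_notMem (by exact hx)]
  simp_rw [h]
  rw [integral_indicator measurableSet_Ici,
    setIntegral_expMeasure_Ici hr (sub_nonneg.2 hu.2)]
  congr 2
  ext x
  congr 1
  ring

lemma uniformAddExp_real_Ici (hM : 0 < M) (hr : 0 < r) :
    (uniformAddExp M r).real (Ici M) = (1 - Real.exp (-(r * M))) / (r * M) := by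
  have := isProbabilityMeasure_expMeasure hr
  have h := setIntegral_uniformAddExp hM hr (f := fun _ => (1 : ℝ)) stronglyMeasurable_const
    (C := 1) (fun x => by simp)
  simpa using h

end UniformAddExp

namespace Params

variable (p : Params) (s : Signalling)

/-- The exponent of the tail of the stationary law. -/
lemma exists_tail_exponent (h : 1 < p.phi s) :
    ∃ r, 0 < r ∧ r = p.lam₁ * (1 - p.expAck s) * (1 - Real.exp (-(r * p.M))) := by
  obtain ⟨θ, hθ0, hθ, hθ'⟩ := p.exists_growth_lt_one s h
  have hlam := p.lam₁_pos
  have hq0 := p.expAck_nonneg s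
  have hq1 := p.expAck_lt_one s
  have hc : ContinuousOn (fun r => p.lam₁ * (1 - p.expAck s) * (1 - Real.exp (-(r * p.M))) - r)
      (Icc θ p.lam₁) := by fun_prop
  have hle : p.lam₁ * (1 - p.expAck s) * (1 - Real.exp (-(p.lam₁ * p.M))) - p.lam₁ ≤ 0 := by
    have h1 := Real.exp_pos (-(p.lam₁ * p.M))
    have h2 : (1 - p.expAck s) * (1 - Real.exp (-(p.lam₁ * p.M))) ≤ 1 := by nlinarith
    nlinarith
  -- The equation always has the root 0. Searching on [θ, `lam₁`] with θ > 0 excludes it.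
  obtain ⟨r, hr, hr'⟩ := intermediate_value_Icc' hθ.le hc ⟨hle, (sub_pos.2 hθ').le⟩
  exact ⟨r, hθ0.trans_le hr.1, (sub_eq_zero.1 hr').symm⟩

lemma op_eq_add_indicator {E : Type*} [NormedAddCommGroup E] [NormedSpace ℝ E] (f : ℝ → E)
    (b : ℝ) : p.op s f b = p.avg f b + (Ici p.M).indicator
      (fun b => (1 - p.expAck s) • (p.avg f (b - p.M) - p.avg f b)) b := by
  unfold op
  split_ifs with hb
  · rw [indicator_of_mem (by exact hb), smul_sub, sub_smul 1 (p.expAck s) (p.avg f b), one_smul]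
    abel
  · rw [indicator_of_notMem (by exact hb), add_zero]

lemma avg_cexp (t z : ℝ) : p.avg (fun x : ℝ => Complex.exp (t * x * Complex.I)) z
    = p.lam₁ / (p.lam₁ - t * Complex.I) * Complex.exp (t * z * Complex.I) := by
  unfold avg
  have h : ∀ x : ℝ, Complex.exp (t * (z + x : ℝ) * Complex.I)
      = Complex.exp (t * z * Complex.I) * Complex.exp (t * x * Complex.I) := by
    intro x; rw [← Complex.exp_add]; push_cast; ring_nf
  simp_rw [h]
  rw [integral_const_mul, integral_cexp_expMeasure p.lam₁_pos, mul_comm]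

/-- Compare characteristic functions. Let m, ρ, χ be those of the uniform law, of the exponential of
rate r and of the harvested energy. Above `M` the law is a multiple of a shifted exponential, so one
step gives χ ρ (m + (1 - f(M)) / (lam₁ M)), the coefficient coming from the equation for r.
Uniformity gives f(M) - 1 = i t M m, and χ (1 - i t / lam₁) = 1 finishes. -/
lemma isStationaryLaw_uniformAddExp {r : ℝ} (hr : 0 < r)
    (hr' : r = p.lam₁ * (1 - p.expAck s) * (1 - Real.exp (-(r * p.M)))) :
    p.IsStationaryLaw s (uniformAddExp p.M r) := by
  have hM := p.M_pos
  have hlam := p.lam₁_pos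
  have hP := isProbabilityMeasure_uniformAddExp hM hr
  have hE := isProbabilityMeasure_expMeasure hr
  have hU := isProbabilityMeasure_uniformLaw hM
  refine ⟨hP, ae_nonneg_uniformAddExp hM hr, ?_⟩
  change p.nextLaw s (uniformAddExp p.M r) = uniformAddExp p.M r
  refine Measure.ext_of_charFun ?_
  ext t
  rw [charFun_apply_real, charFun_apply_real]
  set f : ℝ → ℂ := fun x => Complex.exp (t * x * Complex.I) with hfdef
  have hf : StronglyMeasurable f := by
    apply Continuous.stronglyMeasurable; fun_prop
  have hadd : ∀ z x : ℝ, f (z + x) = f z * f x := by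
    intro z x; simp only [hfdef]; rw [← Complex.exp_add]; push_cast; ring_nf
  have hn : ∀ x, ‖f x‖ ≤ 1 := fun x => by
    have : (t * x * Complex.I : ℂ) = ((t * x : ℝ) : ℂ) * Complex.I := by push_cast; rfl
    simp only [hfdef]
    rw [this, Complex.norm_exp_ofReal_mul_I]
  change ∫ x, f x ∂_ = ∫ x, f x ∂_
  rw [p.integral_nextLaw s hf hn]
  have havg : ∀ z, p.avg f z = p.lam₁ / (p.lam₁ - t * Complex.I) * f z := p.avg_cexp t
  have hρ : ∫ x, f x ∂expMeasure r = r / (r - t * Complex.I) := integral_cexp_expMeasure hr t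
  set χ : ℂ := p.lam₁ / (p.lam₁ - t * Complex.I) with hχ
  set ρ : ℂ := r / (r - t * Complex.I)
  have hfi : Integrable f (uniformAddExp p.M r) := integrable_of_norm_le hf hn
  have hop : ∀ b, p.op s f b = χ * f b + (Ici p.M).indicator
      (fun b => (((1 - p.expAck s : ℝ) : ℂ) * (χ * (f (-p.M) - 1))) * f b) b := by
    intro b
    rw [op_eq_add_indicator, havg]
    congr 2
    ext b
    have h1 : f (b - p.M) = f b * f (-p.M) := by rw [sub_eq_add_neg, hadd]
    rw [havg, havg, h1, Complex.real_smul]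
    ring
  simp_rw [hop]
  rw [integral_add (hfi.const_mul _) ((hfi.const_mul _).indicator measurableSet_Ici),
    integral_const_mul, integral_indicator measurableSet_Ici, integral_const_mul,
    setIntegral_uniformAddExp hM hr hf hn, integral_uniformAddExp hM hr hf hn]
  simp_rw [hadd, integral_const_mul, integral_mul_const, hρ]
  set m : ℂ := ∫ u, f u ∂uniformLaw p.M with hm
  -- The product form, rather than a quotient, also covers t = 0.
  have hm' : m * (t * Complex.I * p.M) = f p.M - 1 := by
    rcases eq_or_ne t 0 with ht | ht
    · simp [hfdef, ht]
    · have hc : (t * Complex.I : ℂ) ≠ 0 := by simp [ht]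
      have e : ∀ u : ℝ, f u = Complex.exp (t * Complex.I * u) := fun u => by
        simp only [hfdef]; ring_nf
      rw [hm, integral_uniformLaw hM]
      simp_rw [e]
      rw [integral_exp_mul_complex hc, Complex.real_smul]
      push_cast
      simp only [mul_zero, Complex.exp_zero]
      have : (p.M : ℂ) ≠ 0 := by exact_mod_cast hM.ne'
      have ht' : (t : ℂ) ≠ 0 := by exact_mod_cast ht
      field_simp
  have hinv : f (-p.M) * f p.M = 1 := by
    rw [← hadd]; simp [hfdef]
  -- Flow balance: the NACK probability times the mass above `M` is mean supply over `M`. This is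
  -- the equation for r.
  have hκ : (1 - p.expAck s) * ((1 - Real.exp (-(r * p.M))) / (r * p.M)) = 1 / (p.lam₁ * p.M) := by
    field_simp
    linear_combination -hr'
  have hκ' : ((1 - p.expAck s : ℝ) : ℂ) * (((1 - Real.exp (-(r * p.M))) / (r * p.M) : ℝ) : ℂ)
      = 1 / (p.lam₁ * p.M) := by
    rw [← Complex.ofReal_mul, hκ]; push_cast; rfl
  rw [Complex.real_smul]
  have hl : (p.lam₁ - t * Complex.I : ℂ) ≠ 0 := fun h => by
    have := congrArg Complex.re h
    simp at this
    exact hlam.ne' this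
  have hl' : (p.lam₁ : ℂ) ≠ 0 := by exact_mod_cast hlam.ne'
  have hM' : (p.M : ℂ) ≠ 0 := by exact_mod_cast hM.ne'
  have step : χ * (m * ρ) + ((1 - p.expAck s : ℝ) : ℂ) * (χ * (f (-p.M) - 1))
      * ((((1 - Real.exp (-(r * p.M))) / (r * p.M) : ℝ) : ℂ) * (f p.M * ρ))
      = χ * ρ * (m + (1 / (p.lam₁ * p.M)) * (1 - f p.M)) := by
    linear_combination χ * (f (-p.M) - 1) * f p.M * ρ * hκ'
      + χ * ρ * (1 / (p.lam₁ * p.M)) * hinv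
  rw [step]
  have e1 : (1 : ℂ) - f p.M = -(m * (t * Complex.I * p.M)) := by linear_combination hm'
  rw [e1, hχ]
  field_simp
  ring

lemma existsUnique_isStationaryLaw (h : 1 < p.phi s) :
    (∃! π : Measure ℝ, p.IsStationaryLaw s π) ∧
      ∀ π : Measure ℝ, p.IsStationaryLaw s π → π.real (Ici p.M) = 1 / p.phi s := by
  obtain ⟨r, hr, hr'⟩ := p.exists_tail_exponent s h
  have hS := p.isStationaryLaw_uniformAddExp s hr hr'
  refine ⟨⟨_, hS, fun π hπ => p.isStationaryLaw_unique s h hπ hS⟩, fun π hπ => ?_⟩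
  rw [p.isStationaryLaw_unique s h hπ hS, uniformAddExp_real_Ici p.M_pos hr]
  have h1 := p.M_pos
  have h2 := p.lam₁_pos
  have h3 : 0 < 1 - p.expAck s := sub_pos.2 (p.expAck_lt_one s)
  unfold phi
  field_simp
  linear_combination -hr'

end Params

/-! ### Case `phi` ≤ 1: low levels lose their mass -/

/-- The offset 1 / r is chosen so that averaging z - x + 1 / r over exponential x < z returns
exactly z: adding harvested energy removes the offset. -/
lemma integral_affine_mul_exp {r : ℝ} (hr : 0 < r) (z ε m : ℝ) :
    ∫ x in (0)..z, (r * Real.exp (-(r * x))) • (ε * (z - x + 1 / r) + m)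
      = ε * z + m * (1 - Real.exp (-(r * z))) := by
  have hd : ∀ x ∈ uIcc 0 z, HasDerivAt
      (fun x => -Real.exp (-(r * x)) * (ε * (z - x + 1 / r) + m) + ε / r * Real.exp (-(r * x)))
      ((r * Real.exp (-(r * x))) • (ε * (z - x + 1 / r) + m)) x := by
    intro x _
    have h1 : HasDerivAt (fun x => Real.exp (-(r * x))) (Real.exp (-(r * x)) * (-(r * 1))) x :=
      (((hasDerivAt_id x).const_mul r).neg).exp
    have h2 : HasDerivAt (fun x => ε * (z - x + 1 / r) + m) (ε * (-1)) x :=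
      ((((hasDerivAt_id x).const_sub z).add_const (1 / r)).const_mul ε).add_const m
    convert! (h1.neg.mul h2).add (h1.const_mul (ε / r)) using 1
    simp only [smul_eq_mul, Pi.neg_apply]
    field_simp
    ring
  rw [intervalIntegral.integral_eq_sub_of_hasDerivAt hd
    (Continuous.intervalIntegrable (by fun_prop) _ _)]
  simp only [mul_zero, neg_zero, Real.exp_zero, sub_self, sub_zero]
  field_simp
  ring

namespace Params

variable (p : Params) (s : Signalling)

/-- Bound on the law of `b + x` from a bound on the law of `b`, with `x` exponential. -/
lemma integral_expMeasure_Iio_sub_le {μ : Measure ℝ} [IsProbabilityMeasure μ]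
    (hμ : ∀ᵐ b ∂μ, 0 ≤ b) {ε m : ℝ}
    (h : ∀ y, 0 < y → μ.real (Iio y) ≤ ε * (y + 1 / p.lam₁) + m) {z : ℝ} (hz : 0 < z) :
    ∫ b, (expMeasure p.lam₁).real (Iio (z - b)) ∂μ
      ≤ ε * z + m * (1 - Real.exp (-(p.lam₁ * z))) := by
  have hset : MeasurableSet {y : ℝ × ℝ | y.1 + y.2 < z} :=
    measurableSet_lt (by fun_prop) (by fun_prop)
  have hi : Integrable ({y : ℝ × ℝ | y.1 + y.2 < z}.indicator (1 : ℝ × ℝ → ℝ))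
      (μ.prod (expMeasure p.lam₁)) := (integrable_const (1 : ℝ)).indicator hset
  have e1 : ∀ b, (expMeasure p.lam₁).real (Iio (z - b))
      = ∫ x, {y : ℝ × ℝ | y.1 + y.2 < z}.indicator (1 : ℝ × ℝ → ℝ) (b, x)
        ∂expMeasure p.lam₁ := by
    intro b
    rw [← integral_indicator_one measurableSet_Iio]
    congr 1
    ext x
    simp only [indicator, mem_Iio, mem_ofPred_eq, lt_sub_iff_add_lt', Pi.one_apply]
  have e2 : ∀ x, ∫ b, {y : ℝ × ℝ | y.1 + y.2 < z}.indicator (1 : ℝ × ℝ → ℝ) (b, x) ∂μ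
      = μ.real (Iio (z - x)) := by
    intro x
    rw [← integral_indicator_one measurableSet_Iio]
    congr 1
    ext b
    simp only [indicator, mem_Iio, mem_ofPred_eq, lt_sub_iff_add_lt, Pi.one_apply]
  simp_rw [e1]
  -- Conditioning on the energy x instead of the level b brings in the distribution function of `μ`
  -- at z - x. For x ≥ z it vanishes, since levels are nonnegative.
  rw [integral_integral_swap
    (f := fun b x => {y : ℝ × ℝ | y.1 + y.2 < z}.indicator (1 : ℝ × ℝ → ℝ) (b, x)) hi]
  simp_rw [e2]
  rw [← integral_affine_mul_exp p.lam₁_pos z ε m,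
    ← setIntegral_expMeasure_Iio p.lam₁_pos hz.le (fun x => ε * (z - x + 1 / p.lam₁) + m),
    ← integral_indicator measurableSet_Iio]
  refine integral_mono_of_nonneg (ae_of_all _ fun x => measureReal_nonneg) ?_
    (ae_of_all _ fun x => ?_)
  · rw [integrable_indicator_iff measurableSet_Iio]
    refine Measure.integrableOn_of_bounded (M := |ε| * (z + 1 / p.lam₁) + |m|)
      (measure_ne_top _ _) (by fun_prop) ?_
    rw [ae_restrict_iff' measurableSet_Iio]
    filter_upwards [ae_nonneg_expMeasure p.lam₁_pos] with x hx hxz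
    have hx' : x < z := hxz
    have hl : 0 < 1 / p.lam₁ := one_div_pos.2 p.lam₁_pos
    rw [Real.norm_eq_abs]
    refine (abs_add_le _ _).trans ?_
    rw [abs_mul, abs_of_pos (show 0 < z - x + 1 / p.lam₁ by linarith)]
    have : |ε| * (z - x + 1 / p.lam₁) ≤ |ε| * (z + 1 / p.lam₁) :=
      mul_le_mul_of_nonneg_left (by linarith) (abs_nonneg ε)
    linarith
  · simp only
    by_cases hx : x < z
    · rw [indicator_of_mem (by exact hx)]
      exact h _ (sub_pos.2 hx)
    · rw [indicator_of_notMem (by exact hx)]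
      refine le_of_eq ((measureReal_eq_zero_iff (measure_ne_top _ _)).2 ?_)
      refine measure_mono_null ?_ (ae_iff.1 hμ)
      intro b hb
      have hb' : b < z - x := hb
      simp only [mem_ofPred_eq]
      linarith

lemma iterate_nextLaw_spec (μ : Measure ℝ) [hP : IsProbabilityMeasure μ] (hμ : ∀ᵐ b ∂μ, 0 ≤ b)
    (n : ℕ) : IsProbabilityMeasure ((p.nextLaw s)^[n] μ) ∧
      ∀ᵐ b ∂(p.nextLaw s)^[n] μ, 0 ≤ b := by
  induction n with
  | zero => exact ⟨hP, hμ⟩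
  | succ n ih =>
    rw [Function.iterate_succ_apply']
    have := ih.1
    exact ⟨inferInstance, p.nextLaw_nonneg s ih.2⟩

lemma nextLaw_real_Iio_le {μ : Measure ℝ} [IsProbabilityMeasure μ] (hμ : ∀ᵐ b ∂μ, 0 ≤ b)
    {ε m : ℝ} (h : ∀ y, 0 < y → μ.real (Iio y) ≤ ε * (y + 1 / p.lam₁) + m) {y : ℝ}
    (hy : 0 < y) :
    (p.nextLaw s μ).real (Iio y)
      ≤ (1 - p.expAck s) * (ε * (y + p.M) + m * (1 - Real.exp (-(p.lam₁ * (y + p.M)))))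
        + p.expAck s * (ε * y + m * (1 - Real.exp (-(p.lam₁ * y)))) := by
  have h0 := p.expAck_nonneg s
  have h3 : 0 ≤ 1 - p.expAck s := sub_nonneg.2 (p.expAck_lt_one s).le
  have hf : StronglyMeasurable ((Iio y).indicator (1 : ℝ → ℝ)) :=
    stronglyMeasurable_one.indicator measurableSet_Iio
  have h1 : ∀ x, ‖(Iio y).indicator (1 : ℝ → ℝ) x‖ ≤ 1 := fun x => by
    by_cases hx : x ∈ Iio y <;> simp [indicator, hx]
  have havg : ∀ z, p.avg ((Iio y).indicator (1 : ℝ → ℝ)) z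
      = (expMeasure p.lam₁).real (Iio (y - z)) := by
    intro z
    rw [← integral_indicator_one measurableSet_Iio]
    unfold avg
    congr 1
    ext x
    simp only [indicator, mem_Iio, lt_sub_iff_add_lt', Pi.one_apply]
  have hint : ∀ z, Integrable (fun b => (expMeasure p.lam₁).real (Iio (z - b))) μ := by
    intro z
    have hanti : Antitone fun b => (expMeasure p.lam₁).real (Iio (z - b)) := fun a b hab =>
      measureReal_mono (Iio_subset_Iio (by linarith))
    refine Integrable.of_bound hanti.measurable.aestronglyMeasurable 1 (ae_of_all _ fun b => ?_)
    rw [Real.norm_of_nonneg measureReal_nonneg]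
    exact measureReal_le_one
  -- Below `M` the bound pretends that the level may still drop by `M`. This only enlarges the
  -- probability of ending below y and makes the recursion the same for all b.
  have hle : ∀ b, p.op s ((Iio y).indicator (1 : ℝ → ℝ)) b
      ≤ (1 - p.expAck s) * (expMeasure p.lam₁).real (Iio (y + p.M - b))
        + p.expAck s * (expMeasure p.lam₁).real (Iio (y - b)) := by
    intro b
    unfold op
    simp only [havg, smul_eq_mul]
    split_ifs
    · rw [show y - (b - p.M) = y + p.M - b by ring]
    · have : (expMeasure p.lam₁).real (Iio (y - b))
          ≤ (expMeasure p.lam₁).real (Iio (y + p.M - b)) :=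
        measureReal_mono (Iio_subset_Iio (by linarith [p.M_pos]))
      nlinarith
  rw [← integral_indicator_one measurableSet_Iio, p.integral_nextLaw s hf h1]
  refine (integral_mono (integrable_of_norm_le (p.stronglyMeasurable_op s hf)
    (p.norm_op_le s h1)) (((hint _).const_mul _).add ((hint _).const_mul _)) hle).trans ?_
  simp only [Pi.add_apply]
  rw [integral_add ((hint _).const_mul _) ((hint _).const_mul _), integral_const_mul,
    integral_const_mul]
  exact add_le_add
    (mul_le_mul_of_nonneg_left
      (p.integral_expMeasure_Iio_sub_le hμ h (add_pos hy p.M_pos)) h3)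
    (mul_le_mul_of_nonneg_left (p.integral_expMeasure_Iio_sub_le hμ h hy) h0)

/-- Without positive drift towards the origin, low levels become unlikely. -/
lemma iterate_nextLaw_real_Iio_le (h : p.phi s ≤ 1) (μ : Measure ℝ) [IsProbabilityMeasure μ]
    (hμ : ∀ᵐ b ∂μ, 0 ≤ b) {ε : ℝ} (hε : 0 < ε) (n : ℕ) {y : ℝ} (hy : 0 < y) :
    ((p.nextLaw s)^[n] μ).real (Iio y)
      ≤ ε * (y + 1 / p.lam₁) + (1 - Real.exp (-(p.lam₁ * (1 / ε + p.M)))) ^ n := by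
  have hlam := p.lam₁_pos
  have hl : 0 < 1 / p.lam₁ := one_div_pos.2 hlam
  have hM := p.M_pos
  have hδ : 0 ≤ 1 - Real.exp (-(p.lam₁ * (1 / ε + p.M))) := by
    have : 0 ≤ p.lam₁ * (1 / ε + p.M) := by positivity
    simpa using this
  induction n generalizing y with
  | zero =>
    have : μ.real (Iio y) ≤ 1 := measureReal_le_one
    have h2 : 0 ≤ ε * (y + 1 / p.lam₁) := by positivity
    simp only [Function.iterate_zero, id, pow_zero]
    linarith
  | succ n ih =>
    obtain ⟨hP, hnn⟩ := p.iterate_nextLaw_spec s μ hμ n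
    rw [Function.iterate_succ_apply', pow_succ]
    set δ := Real.exp (-(p.lam₁ * (1 / ε + p.M))) with hδdef
    have hm : 0 ≤ (1 - δ) ^ n := pow_nonneg hδ n
    -- For y ≥ 1 / ε the claimed bound exceeds 1. Otherwise y + M < 1 / ε + M, and the harvested
    -- energy exceeds that level with probability at least δ, whence the factor 1 - δ.
    rcases le_or_gt (1 / ε) y with hyε | hyε
    · have h1 : (p.nextLaw s ((p.nextLaw s)^[n] μ)).real (Iio y) ≤ 1 := measureReal_le_one
      rw [div_le_iff₀' hε] at hyε
      have h2 : 0 ≤ ε * (1 / p.lam₁) := by positivity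
      have h3 := mul_nonneg hm hδ
      linarith
    · refine (p.nextLaw_real_Iio_le s hnn (fun y hy => ih hy) hy).trans ?_
      have h0 := p.expAck_nonneg s
      have h3 : 0 ≤ 1 - p.expAck s := sub_nonneg.2 (p.expAck_lt_one s).le
      have b1 : δ ≤ Real.exp (-(p.lam₁ * (y + p.M))) := by
        apply Real.exp_le_exp.2; nlinarith
      have b2 : δ ≤ Real.exp (-(p.lam₁ * y)) := by
        apply Real.exp_le_exp.2; nlinarith
      have c1 : (1 - δ) ^ n * (1 - Real.exp (-(p.lam₁ * (y + p.M)))) ≤ (1 - δ) ^ n * (1 - δ) :=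
        mul_le_mul_of_nonneg_left (by linarith) hm
      have c2 : (1 - δ) ^ n * (1 - Real.exp (-(p.lam₁ * y))) ≤ (1 - δ) ^ n * (1 - δ) :=
        mul_le_mul_of_nonneg_left (by linarith) hm
      have d1 := mul_le_mul_of_nonneg_left c1 h3
      have d2 := mul_le_mul_of_nonneg_left c2 h0
      -- The mean demand, which raises y to y + (1 - q) M, is at most the removed offset 1 / `lam₁`:
      -- this is `phi` ≤ 1, and equality is harmless.
      have d3 : (1 - p.expAck s) * p.M ≤ 1 / p.lam₁ := by
        rw [le_div_iff₀ hlam]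
        unfold phi at h
        linarith
      have d4 := mul_le_mul_of_nonneg_left d3 hε.le
      linarith

lemma tendsto_iterate_nextLaw_real_Ici (h : p.phi s ≤ 1) (μ : Measure ℝ)
    [IsProbabilityMeasure μ] (hμ : ∀ᵐ b ∂μ, 0 ≤ b) :
    Tendsto (fun n => ((p.nextLaw s)^[n] μ).real (Ici p.M)) atTop (𝓝 1) := by
  have hlam := p.lam₁_pos
  have hM := p.M_pos
  have key : Tendsto (fun n => ((p.nextLaw s)^[n] μ).real (Iio p.M)) atTop (𝓝 0) := by
    rw [Metric.tendsto_atTop']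
    intro η hη
    set ε := η / (2 * (p.M + 1 / p.lam₁)) with hε
    have hε0 : 0 < ε := by positivity
    have hεM : ε * (p.M + 1 / p.lam₁) = η / 2 := by rw [hε]; field_simp
    have hδ : 0 ≤ 1 - Real.exp (-(p.lam₁ * (1 / ε + p.M))) := by
      have : 0 ≤ p.lam₁ * (1 / ε + p.M) := by positivity
      simpa using this
    have ht := tendsto_pow_atTop_nhds_zero_of_lt_one hδ
      (sub_lt_self 1 (Real.exp_pos (-(p.lam₁ * (1 / ε + p.M)))))
    obtain ⟨N, hN⟩ := eventually_atTop.1 (ht.eventually_lt_const (half_pos hη))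
    refine ⟨N, fun n hn => ?_⟩
    have h1 := p.iterate_nextLaw_real_Iio_le s h μ hμ hε0 n hM
    have h2 := hN n hn.le
    rw [Real.dist_eq, sub_zero, abs_of_nonneg measureReal_nonneg]
    linarith
  have := key.const_sub 1
  rw [sub_zero] at this
  refine this.congr fun n => ?_
  have hP := (p.iterate_nextLaw_spec s μ hμ n).1
  rw [← compl_Iio, probReal_compl_eq_one_sub measurableSet_Iio]

end Params

/-! ### Independence of the buffer level from the current interval -/

/-- Both hypotheses factor the law of (A, B, C) into three marginals; reassociating the product
groups A with B. -/
lemma indepFun_prodMk_left {Ω α β γ : Type*} [MeasurableSpace Ω] [MeasurableSpace α]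
    [MeasurableSpace β] [MeasurableSpace γ] {P : Measure Ω} [IsProbabilityMeasure P] {A : Ω → α}
    {B : Ω → β} {C : Ω → γ} (hA : Measurable A) (hB : Measurable B) (hC : Measurable C)
    (h1 : IndepFun A (fun ω => (B ω, C ω)) P) (h2 : IndepFun B C P) :
    IndepFun (fun ω => (A ω, B ω)) C P := by
  have := Measure.isProbabilityMeasure_map (μ := P) hA.aemeasurable
  have := Measure.isProbabilityMeasure_map (μ := P) hB.aemeasurable
  have := Measure.isProbabilityMeasure_map (μ := P) hC.aemeasurable
  have e2 := (indepFun_iff_map_prod_eq_prod_map_map hB.aemeasurable hC.aemeasurable).1 h2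
  have hAB : IndepFun A B P := h1.comp measurable_id measurable_fst
  have e1 := (indepFun_iff_map_prod_eq_prod_map_map hA.aemeasurable
    (hB.prodMk hC).aemeasurable).1 h1
  rw [indepFun_iff_map_prod_eq_prod_map_map (hA.prodMk hB).aemeasurable hC.aemeasurable,
    (indepFun_iff_map_prod_eq_prod_map_map hA.aemeasurable hB.aemeasurable).1 hAB]
  have h := Measure.prodAssoc_prod (μ := P.map A) (ν := P.map B) (τ := P.map C)
  rw [← e2, ← e1] at h
  have h' := congrArg (Measure.map MeasurableEquiv.prodAssoc.symm) h
  rw [Measure.map_map (by fun_prop) (by fun_prop), Measure.map_map (by fun_prop) (by fun_prop)]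
    at h'
  simp only [MeasurableEquiv.symm_comp_self, Measure.map_id] at h'
  rw [h']
  rfl

namespace Inputs

variable {p : Params} {Ω : Type*} [MeasurableSpace Ω] {P : Measure Ω} (N : Inputs p P)
  (s : Signalling)

/-- All the inputs of the interval `i`. -/
def slot (i : ℕ) (ω : Ω) : ℂ × ℂ × ℂ × ℝ := (N.hSR i ω, N.hRD i ω, N.hSD i ω, N.X i ω)

lemma measurable_slot (i : ℕ) : Measurable (N.slot i) :=
  (N.measurable_hSR i).prodMk ((N.measurable_hRD i).prodMk
    ((N.measurable_hSD i).prodMk (N.measurable_X i)))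

lemma map_slot (i : ℕ) : P.map (N.slot i) = p.slotLaw := N.slot_law i

lemma buffer_succ (i : ℕ) (ω : Ω) : N.buffer s (i + 1) ω = p.bufferStep s (N.buffer s i ω)
    (N.slot i ω).2.2.2 (p.snrFromSource (N.slot i ω).2.2.1) := rfl

/-- Makes causality explicit: interval i itself is not among the arguments of g, which gives
independence from it. -/
lemma exists_buffer_eq (i : ℕ) :
    ∃ g : ℝ × (Finset.range i → ℂ × ℂ × ℂ × ℝ) → ℝ, Measurable g ∧
      ∀ ω, N.buffer s i ω = g (N.B₀ ω, fun j => N.slot j ω) := by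
  induction i with
  | zero => exact ⟨Prod.fst, measurable_fst, fun ω => rfl⟩
  | succ i ih =>
    obtain ⟨g, hg, hgb⟩ := ih
    have hsub : ∀ j : Finset.range i, (j : ℕ) ∈ Finset.range (i + 1) := fun j =>
      Finset.range_mono (Nat.le_succ i) j.2
    have hi : i ∈ Finset.range (i + 1) := Finset.self_mem_range_succ i
    refine ⟨(fun z : ℝ × ℂ × ℂ × ℂ × ℝ =>
      p.bufferStep s z.1 z.2.2.2.2 (p.snrFromSource z.2.2.2.1)) ∘
        fun y => (g (y.1, fun j => y.2 ⟨j, hsub j⟩), y.2 ⟨i, hi⟩), ?_, fun ω => ?_⟩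
    · have h1 : Measurable fun y : ℝ × (Finset.range (i + 1) → ℂ × ℂ × ℂ × ℝ) =>
          g (y.1, fun j => y.2 ⟨j, hsub j⟩) :=
        hg.comp (measurable_fst.prodMk (measurable_pi_lambda _ fun j =>
          (measurable_pi_apply _).comp measurable_snd))
      have h2 : Measurable fun y : ℝ × (Finset.range (i + 1) → ℂ × ℂ × ℂ × ℝ) =>
          y.2 ⟨i, hi⟩ := (measurable_pi_apply _).comp measurable_snd
      exact (p.measurable_nextLaw_map s).comp (h1.prodMk h2)
    · rw [buffer_succ, hgb, Function.comp_apply]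

lemma measurable_buffer (i : ℕ) : Measurable (N.buffer s i) := by
  obtain ⟨g, hg, h⟩ := N.exists_buffer_eq s i
  have : N.buffer s i = fun ω => g (N.B₀ ω, fun j => N.slot j ω) := funext h
  rw [this]
  exact hg.comp (N.measurable_B₀.prodMk (measurable_pi_lambda _ fun j => N.measurable_slot j))

lemma map_B₀_nonneg : ∀ᵐ b ∂P.map N.B₀, 0 ≤ b :=
  (ae_map_iff N.measurable_B₀.aemeasurable measurableSet_Ici).2 N.B₀_nonneg

variable [IsProbabilityMeasure P]

lemma indepFun_buffer_slot (i : ℕ) : IndepFun (N.buffer s i) (N.slot i) P := by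
  have hpast : Measurable fun ω (j : Finset.range i) => N.slot j ω :=
    measurable_pi_lambda _ fun j => N.measurable_slot j
  have h2 : IndepFun (fun ω (j : Finset.range i) => N.slot j ω) (N.slot i) P :=
    (iIndepFun.indepFun_finset (f := N.slot) (Finset.range i) {i} (by simp) N.slot_indep
      N.measurable_slot).comp measurable_id
      (measurable_pi_apply (⟨i, Finset.mem_singleton_self i⟩ : ({i} : Finset ℕ)))
  have h1 : IndepFun N.B₀ (fun ω => ((fun j : Finset.range i => N.slot j ω), N.slot i ω)) P :=
    N.init_indep.comp (ψ := fun y : ℕ → ℂ × ℂ × ℂ × ℝ => ((fun j : Finset.range i => y j), y i))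
      measurable_id (by fun_prop)
  obtain ⟨g, hg, h⟩ := N.exists_buffer_eq s i
  have e : N.buffer s i = fun ω => g (N.B₀ ω, fun j => N.slot j ω) := funext h
  rw [e]
  exact (indepFun_prodMk_left N.measurable_B₀ hpast (N.measurable_slot i) h1 h2).comp hg
    measurable_id

lemma map_buffer_slot (i : ℕ) :
    P.map (fun ω => (N.buffer s i ω, N.slot i ω)) = (P.map (N.buffer s i)).prod p.slotLaw := by
  rw [(indepFun_iff_map_prod_eq_prod_map_map (N.measurable_buffer s i).aemeasurable
    (N.measurable_slot i).aemeasurable).1 (N.indepFun_buffer_slot s i), map_slot]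

lemma map_buffer (i : ℕ) : P.map (N.buffer s i) = (p.nextLaw s)^[i] (P.map N.B₀) := by
  induction i with
  | zero => rfl
  | succ i ih =>
    rw [Function.iterate_succ_apply', ← ih, Params.nextLaw, ← map_buffer_slot, Measure.map_map
      (p.measurable_nextLaw_map s) ((N.measurable_buffer s i).prodMk (N.measurable_slot i))]
    rfl

instance isProbabilityMeasure_map_B₀ : IsProbabilityMeasure (P.map N.B₀) :=
  Measure.isProbabilityMeasure_map N.measurable_B₀.aemeasurable

lemma availProb_eq (i : ℕ) :
    N.availProb s i = ((p.nextLaw s)^[i] (P.map N.B₀)).real (Ici p.M) := by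
  rw [← map_buffer, map_measureReal_apply (N.measurable_buffer s i) measurableSet_Ici]
  rfl

/-- The outage event in terms of the buffer level and the inputs of the interval. -/
def outageEvent (p : Params) (s : Signalling) (b : ℝ) : Set (ℂ × ℂ × ℂ × ℝ) :=
  {z | (p.snrFromSource z.2.2.1 : EReal) < p.ackThreshold s ∧
    min (p.snrFromSource z.1) (p.snrFromRelay b z.2.1 + p.snrFromSource z.2.2.1) < p.Gth}

lemma measurableSet_outageEvent :
    MeasurableSet {y : ℝ × ℂ × ℂ × ℂ × ℝ | y.2 ∈ outageEvent p s y.1} := by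
  have h := p.measurable_snrFromSource
  have hR : Measurable fun y : ℝ × ℂ × ℂ × ℂ × ℝ => p.snrFromRelay y.1 y.2.2.1 := by
    unfold Params.snrFromRelay Params.relayPower
    refine Measurable.div_const (Measurable.mul (Measurable.ite ?_ measurable_const
      measurable_const) (by fun_prop)) _
    exact measurableSet_le measurable_const measurable_fst
  have h1 : Measurable fun y : ℝ × ℂ × ℂ × ℂ × ℝ => (p.snrFromSource y.2.2.2.1 : EReal) :=
    measurable_coe_real_ereal.comp (by fun_prop)
  have h2 : Measurable fun y : ℝ × ℂ × ℂ × ℂ × ℝ => min (p.snrFromSource y.2.1)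
      (p.snrFromRelay y.1 y.2.2.1 + p.snrFromSource y.2.2.2.1) :=
    Measurable.min (by fun_prop) (hR.add (by fun_prop))
  exact (measurableSet_lt h1 measurable_const).inter (measurableSet_lt h2 measurable_const)

lemma snrFromRelay_of_le {b : ℝ} (hb : p.M ≤ b) (h : ℂ) :
    p.snrFromRelay b h = 2 * p.M * ‖h‖ ^ 2 / p.noise := by
  unfold Params.snrFromRelay Params.relayPower
  rw [if_pos hb]
  ring

lemma snrFromRelay_of_lt {b : ℝ} (hb : b < p.M) (h : ℂ) : p.snrFromRelay b h = 0 := by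
  unfold Params.snrFromRelay Params.relayPower
  rw [if_neg (not_le.2 hb)]
  ring

lemma outageProb_eq_real (i : ℕ) : N.outageProb s i
    = P.real {ω | N.slot i ω ∈ outageEvent p s (N.buffer s i ω)} := by
  have hn : MeasurableSet (N.nack s i) :=
    measurableSet_lt (measurable_coe_real_ereal.comp
      (p.measurable_snrFromSource.comp (N.measurable_hSD i))) measurable_const
  unfold outageProb
  rw [Measure.real, Measure.real, cond_apply hn, ENNReal.toReal_mul, ENNReal.toReal_inv,
    ← Measure.real, ← Measure.real]
  have hset : {ω | N.slot i ω ∈ outageEvent p s (N.buffer s i ω)} = N.nack s i ∩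
      {ω | min (N.snrSR i ω) (N.snrRD s i ω + N.snrSD i ω) < p.Gth} := rfl
  rw [hset]
  -- Conditioning on a null event yields the value 0 here; the identity survives because the outage
  -- event lies inside the NACK event.
  rcases eq_or_ne (P.real (N.nack s i)) 0 with h0 | h0
  · rw [h0, zero_mul]
    refine le_antisymm measureReal_nonneg ?_
    rw [← h0]
    exact measureReal_mono inter_subset_left
  · rw [mul_inv_cancel_left₀ h0]

/-- The outage probability given the law of the buffer level. -/
lemma outageProb_eq {u v : ℝ} (hu : ∀ b, p.M ≤ b → p.slotLaw.real (outageEvent p s b) = u)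
    (hv : ∀ b, b < p.M → p.slotLaw.real (outageEvent p s b) = v) (i : ℕ) :
    N.outageProb s i = N.availProb s i * u + (1 - N.availProb s i) * v := by
  have hS := measurableSet_outageEvent (p := p) s
  have hm := (N.measurable_buffer s i).prodMk (N.measurable_slot i)
  have hP := Measure.isProbabilityMeasure_map (μ := P) (N.measurable_buffer s i).aemeasurable
  have e1 : N.outageProb s i = ((P.map (N.buffer s i)).prod p.slotLaw).real
      {y : ℝ × ℂ × ℂ × ℂ × ℝ | y.2 ∈ outageEvent p s y.1} := by
    rw [← map_buffer_slot, map_measureReal_apply hm hS, outageProb_eq_real]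
    rfl
  have e2 : ∀ b, ∫ z, {y : ℝ × ℂ × ℂ × ℂ × ℝ | y.2 ∈ outageEvent p s y.1}.indicator
      (1 : ℝ × ℂ × ℂ × ℂ × ℝ → ℝ) (b, z) ∂p.slotLaw
      = (Ici p.M).indicator (fun _ => u) b + (Ici p.M)ᶜ.indicator (fun _ => v) b := by
    intro b
    have e3 : ∫ z, {y : ℝ × ℂ × ℂ × ℂ × ℝ | y.2 ∈ outageEvent p s y.1}.indicator
        (1 : ℝ × ℂ × ℂ × ℂ × ℝ → ℝ) (b, z) ∂p.slotLaw = p.slotLaw.real (outageEvent p s b) := by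
      have hb : MeasurableSet (outageEvent p s b) := measurable_prodMk_left (x := b) hS
      rw [← integral_indicator_one hb]
      rfl
    rw [e3]
    by_cases hb : p.M ≤ b
    · simp [hb, hu b hb]
    · simp [indicator, hb, hv b (not_le.1 hb)]
  rw [e1, ← integral_indicator_one hS, integral_prod
    ({y : ℝ × ℂ × ℂ × ℂ × ℝ | y.2 ∈ outageEvent p s y.1}.indicator 1)
    ((integrable_const (1 : ℝ)).indicator hS)]
  simp_rw [e2]
  rw [integral_add ((integrable_const _).indicator measurableSet_Ici)
    ((integrable_const _).indicator measurableSet_Ici.compl),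
    integral_indicator_const _ measurableSet_Ici,
    integral_indicator_const _ measurableSet_Ici.compl,
    probReal_compl_eq_one_sub measurableSet_Ici, availProb_eq, map_buffer, smul_eq_mul,
    smul_eq_mul]

end Inputs

/-! ### Closed forms for the outage probability in one interval -/

namespace Params

variable (p : Params) (s : Signalling)

lemma map_snr_triple : p.slotLaw.map (fun z => (p.snrFromSource z.1,
      2 * p.M * ‖z.2.1‖ ^ 2 / p.noise, p.snrFromSource z.2.2.1))
    = (expMeasure p.W₄).prod ((expMeasure p.W₁).prod (expMeasure p.W₂)) := by
  have h : (fun z : ℂ × ℂ × ℂ × ℝ => (p.snrFromSource z.1,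
      2 * p.M * ‖z.2.1‖ ^ 2 / p.noise, p.snrFromSource z.2.2.1))
      = Prod.map id (Prod.map id Prod.fst) ∘ p.slotSnr := rfl
  rw [h, ← Measure.map_map (by fun_prop) p.measurable_slotSnr, map_slotSnr,
    ← Measure.map_prod_map _ _ measurable_id (by fun_prop),
    ← Measure.map_prod_map _ _ measurable_id measurable_fst, Measure.map_fst_prod, measure_univ,
    one_smul, Measure.map_id, Measure.map_id]

lemma expMeasure_nack :
    (expMeasure p.W₂).real {γ : ℝ | (γ : EReal) < p.ackThreshold s} = 1 - p.expAck s := by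
  have h : {γ : ℝ | (γ : EReal) < p.ackThreshold s}
      = {γ : ℝ | p.ackThreshold s ≤ (γ : EReal)}ᶜ := by
    ext γ; simp
  rw [h, probReal_compl_eq_one_sub (p.measurableSet_ack s), expMeasure_ack]

lemma coe_lt_ackThreshold {γ : ℝ} (h : γ < p.Gth) : (γ : EReal) < p.ackThreshold s := by
  cases s with
  | incremental => exact EReal.coe_lt_coe_iff.2 h
  | nonIncremental => exact EReal.coe_lt_top γ

/-- Probability of a NACK together with a decoding failure, the relay being heard with gain `c`. -/
lemma slotLaw_real_outage {c : ℝ} (hc : 0 ≤ c) :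
    p.slotLaw.real {z | (p.snrFromSource z.2.2.1 : EReal) < p.ackThreshold s ∧
      min (p.snrFromSource z.1) (c * (2 * p.M * ‖z.2.1‖ ^ 2 / p.noise)
        + p.snrFromSource z.2.2.1) < p.Gth}
    = (1 - Real.exp (-p.W₄ * p.Gth)) * (1 - p.expAck s) + Real.exp (-p.W₄ * p.Gth) *
      ((expMeasure p.W₁).prod (expMeasure p.W₂)).real {w | c * w.1 + w.2 < p.Gth} := by
  have hm : Measurable fun z : ℂ × ℂ × ℂ × ℝ => (p.snrFromSource z.1,
      2 * p.M * ‖z.2.1‖ ^ 2 / p.noise, p.snrFromSource z.2.2.1) := by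
    have := p.measurable_snrFromSource
    fun_prop
  set N : Set ℝ := {γ : ℝ | (γ : EReal) < p.ackThreshold s} with hN
  have hNm : MeasurableSet N := measurableSet_lt measurable_coe_real_ereal measurable_const
  set D : Set (ℝ × ℝ) := {w | c * w.1 + w.2 < p.Gth} with hD
  have hDm : MeasurableSet D := measurableSet_lt (by fun_prop) measurable_const
  have hset : {z : ℂ × ℂ × ℂ × ℝ | (p.snrFromSource z.2.2.1 : EReal) < p.ackThreshold s ∧
      min (p.snrFromSource z.1) (c * (2 * p.M * ‖z.2.1‖ ^ 2 / p.noise)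
        + p.snrFromSource z.2.2.1) < p.Gth}
      = (fun z : ℂ × ℂ × ℂ × ℝ => (p.snrFromSource z.1,
      2 * p.M * ‖z.2.1‖ ^ 2 / p.noise, p.snrFromSource z.2.2.1)) ⁻¹'
        {y | y.2.2 ∈ N ∧ (y.1 < p.Gth ∨ y.2 ∈ D)} := by
    ext z
    simp only [mem_ofPred_eq, mem_preimage, min_lt_iff, hN, hD]
  have hS : MeasurableSet {y : ℝ × ℝ × ℝ | y.2.2 ∈ N ∧ (y.1 < p.Gth ∨ y.2 ∈ D)} :=
    (measurable_snd.snd hNm).inter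
      ((measurableSet_lt measurable_fst measurable_const).union (measurable_snd hDm))
  rw [hset, ← map_measureReal_apply hm hS, map_snr_triple]
  -- If the relay cannot decode, every NACK is an outage. If it can, outage means failure after
  -- combining, which almost surely forces a NACK: the relay term is nonnegative and the ACK
  -- threshold is at least `Gth`. The two cases are disjoint products.
  have hae : {y : ℝ × ℝ × ℝ | y.2.2 ∈ N ∧ (y.1 < p.Gth ∨ y.2 ∈ D)}
      =ᵐ[(expMeasure p.W₄).prod ((expMeasure p.W₁).prod (expMeasure p.W₂))]
      (Iio p.Gth ×ˢ (univ ×ˢ N) ∪ Ici p.Gth ×ˢ D : Set (ℝ × ℝ × ℝ)) := by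
    have h0 : ∀ᵐ y ∂(expMeasure p.W₄).prod ((expMeasure p.W₁).prod (expMeasure p.W₂)),
        0 ≤ y.2.1 := Measure.quasiMeasurePreserving_snd.ae
      (Measure.quasiMeasurePreserving_fst.ae (ae_nonneg_expMeasure p.W₁_pos))
    filter_upwards [h0] with y hy
    apply propext
    change (y.2.2 ∈ N ∧ (y.1 < p.Gth ∨ y.2 ∈ D)) ↔
      ((y.1 < p.Gth ∧ (True ∧ y.2.2 ∈ N)) ∨ (p.Gth ≤ y.1 ∧ y.2 ∈ D))
    have hDN : y.2 ∈ D → y.2.2 ∈ N := fun h => p.coe_lt_ackThreshold s (by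
      have h1 : c * y.2.1 + y.2.2 < p.Gth := h
      have := mul_nonneg hc hy
      linarith)
    rcases lt_or_ge y.1 p.Gth with h | h
    · simp [h, not_le.2 h]
    · simp only [h, not_lt.2 h, false_or, false_and, true_and]
      exact ⟨fun h => h.2, fun h => ⟨hDN h, h⟩⟩
  have hdisj : Disjoint (Iio p.Gth ×ˢ (univ ×ˢ N) : Set (ℝ × ℝ × ℝ)) (Ici p.Gth ×ˢ D) :=
    Set.disjoint_prod.2 (Or.inl (disjoint_left.2 fun x h1 h2 =>
      not_le.2 (mem_Iio.1 h1) (mem_Ici.1 h2)))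
  rw [measureReal_congr hae, measureReal_union hdisj (measurableSet_Ici.prod hDm),
    measureReal_prod_prod, measureReal_prod_prod, measureReal_prod_prod, probReal_univ, one_mul,
    expMeasure_nack, expMeasure_real_Iio p.W₄_pos p.Gth_pos.le,
    expMeasure_real_Ici p.W₄_pos p.Gth_pos.le, neg_mul]

/-- Distribution function of the sum of the relay-destination and source-destination SNRs. -/
lemma expMeasure_prod_real_add_lt (h : p.W₁ ≠ p.W₂) :
    ((expMeasure p.W₁).prod (expMeasure p.W₂)).real {w | 1 * w.1 + w.2 < p.Gth}
    = (1 - Real.exp (-p.W₂ * p.Gth))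
        + p.W₂ * (Real.exp (-p.W₁ * p.Gth) - Real.exp (-p.W₂ * p.Gth)) / (p.W₁ - p.W₂) := by
  have hDm : MeasurableSet {w : ℝ × ℝ | 1 * w.1 + w.2 < p.Gth} :=
    measurableSet_lt (by fun_prop) measurable_const
  have hG := p.Gth_pos
  have hW1 := p.W₁_pos
  have hW2 := p.W₂_pos
  rw [← integral_indicator_one hDm, integral_prod_symm
    ({w : ℝ × ℝ | 1 * w.1 + w.2 < p.Gth}.indicator 1)
    ((integrable_const (1 : ℝ)).indicator hDm)]
  have hin : ∀ᵐ y ∂expMeasure p.W₂,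
      ∫ x, {w : ℝ × ℝ | 1 * w.1 + w.2 < p.Gth}.indicator (1 : ℝ × ℝ → ℝ) (x, y)
        ∂expMeasure p.W₁
      = (Iio p.Gth).indicator (fun y => 1 - Real.exp (-(p.W₁ * (p.Gth - y)))) y := by
    filter_upwards [ae_nonneg_expMeasure hW2] with y hy
    have e : ∫ x, {w : ℝ × ℝ | 1 * w.1 + w.2 < p.Gth}.indicator (1 : ℝ × ℝ → ℝ) (x, y)
        ∂expMeasure p.W₁ = (expMeasure p.W₁).real (Iio (p.Gth - y)) := by
      rw [← integral_indicator_one measurableSet_Iio]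
      congr 1
      ext x
      simp only [indicator, mem_Iio, mem_ofPred_eq, lt_sub_iff_add_lt, Pi.one_apply, one_mul]
    rw [e]
    by_cases hyG : y < p.Gth
    · rw [indicator_of_mem (by exact hyG), expMeasure_real_Iio hW1 (by linarith)]
    · rw [indicator_of_notMem (by exact hyG)]
      refine le_antisymm ?_ measureReal_nonneg
      have := expMeasure_real_Iio hW1 (le_refl 0)
      simp only [mul_zero, neg_zero, Real.exp_zero, sub_self] at this
      rw [← this]
      exact measureReal_mono (Iio_subset_Iio (by linarith))
  rw [integral_congr_ae hin, integral_indicator measurableSet_Iio,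
    setIntegral_expMeasure_Iio hW2 hG.le]
  have hne : p.W₁ - p.W₂ ≠ 0 := sub_ne_zero.2 h
  -- The cross term of the convolution is proportional to exp ((W₁ - W₂) y); its antiderivative has
  -- the denominator W₁ - W₂, hence the hypothesis `h`.
  have hd : ∀ y ∈ uIcc 0 p.Gth, HasDerivAt
      (fun y => -Real.exp (-(p.W₂ * y))
        - p.W₂ / (p.W₁ - p.W₂) * (Real.exp (-(p.W₁ * p.Gth)) * Real.exp ((p.W₁ - p.W₂) * y)))
      ((p.W₂ * Real.exp (-(p.W₂ * y))) • (1 - Real.exp (-(p.W₁ * (p.Gth - y))))) y := by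
    intro y _
    have h1 : HasDerivAt (fun y => Real.exp (-(p.W₂ * y)))
        (Real.exp (-(p.W₂ * y)) * (-(p.W₂ * 1))) y :=
      (((hasDerivAt_id y).const_mul p.W₂).neg).exp
    have h2 : HasDerivAt (fun y => Real.exp ((p.W₁ - p.W₂) * y))
        (Real.exp ((p.W₁ - p.W₂) * y) * ((p.W₁ - p.W₂) * 1)) y :=
      ((hasDerivAt_id y).const_mul (p.W₁ - p.W₂)).exp
    convert! h1.neg.sub ((h2.const_mul (Real.exp (-(p.W₁ * p.Gth)))).const_mul
      (p.W₂ / (p.W₁ - p.W₂))) using 1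
    have e : Real.exp (-(p.W₁ * p.Gth)) * Real.exp ((p.W₁ - p.W₂) * y)
        = Real.exp (-(p.W₂ * y)) * Real.exp (-(p.W₁ * (p.Gth - y))) := by
      rw [← Real.exp_add, ← Real.exp_add]; ring_nf
    rw [smul_eq_mul]
    have e2 : p.W₂ / (p.W₁ - p.W₂) * (Real.exp (-(p.W₁ * p.Gth))
        * (Real.exp ((p.W₁ - p.W₂) * y) * ((p.W₁ - p.W₂) * 1)))
        = p.W₂ * (Real.exp (-(p.W₁ * p.Gth)) * Real.exp ((p.W₁ - p.W₂) * y)) := by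
      field_simp
    rw [e2, e]
    ring
  rw [intervalIntegral.integral_eq_sub_of_hasDerivAt hd
    (Continuous.intervalIntegrable (by fun_prop) _ _)]
  have e : Real.exp (-(p.W₁ * p.Gth)) * Real.exp ((p.W₁ - p.W₂) * p.Gth)
      = Real.exp (-(p.W₂ * p.Gth)) := by
    rw [← Real.exp_add]; ring_nf
  simp only [e, mul_zero, neg_zero, Real.exp_zero, neg_mul]
  ring

lemma expMeasure_prod_real_snd_lt :
    ((expMeasure p.W₁).prod (expMeasure p.W₂)).real {w | 0 * w.1 + w.2 < p.Gth}
    = 1 - Real.exp (-p.W₂ * p.Gth) := by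
  have h : {w : ℝ × ℝ | 0 * w.1 + w.2 < p.Gth} = univ ×ˢ Iio p.Gth := by
    ext w; simp
  rw [h, measureReal_prod_prod, probReal_univ, one_mul, expMeasure_real_Iio p.W₂_pos p.Gth_pos.le,
    neg_mul]

lemma slotLaw_real_outageEvent_of_le (h : p.W₁ ≠ p.W₂) (b : ℝ) (hb : p.M ≤ b) :
    p.slotLaw.real (Inputs.outageEvent p s b) = p.outageAlways s := by
  rw [outageAlways, ← p.expMeasure_prod_real_add_lt h, ← p.slotLaw_real_outage s zero_le_one]
  unfold Inputs.outageEvent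
  simp_rw [Inputs.snrFromRelay_of_le hb, one_mul]

lemma slotLaw_real_outageEvent_of_lt (b : ℝ) (hb : b < p.M) :
    p.slotLaw.real (Inputs.outageEvent p s b)
      = (1 - Real.exp (-p.W₄ * p.Gth)) * (1 - p.expAck s)
        + Real.exp (-p.W₄ * p.Gth) * (1 - Real.exp (-p.W₂ * p.Gth)) := by
  rw [← p.expMeasure_prod_real_snd_lt, ← p.slotLaw_real_outage s le_rfl]
  unfold Inputs.outageEvent
  simp_rw [Inputs.snrFromRelay_of_lt hb, zero_mul]

end Params

end IOFP

/-! ### Conclusion -/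

theorem theorem6 (p : IOFP.Params) (s : IOFP.Signalling)
    {Ω : Type*} [MeasurableSpace Ω] (P : Measure Ω) [IsProbabilityMeasure P]
    (N : IOFP.Inputs p P) :
    (1 < p.phi s →
      (∃! π : Measure ℝ, p.IsStationaryLaw s π) ∧
      (∀ π : Measure ℝ, p.IsStationaryLaw s π → π.real (Ici p.M) = 1 / p.phi s) ∧
      Tendsto (N.availProb s) atTop (𝓝 (1 / p.phi s)) ∧
      (p.W₁ ≠ p.W₂ →
        (p.IsStationaryLaw s (P.map N.B₀) → ∀ i, N.outageProb s i = p.outageOnOff s) ∧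
        Tendsto (N.outageProb s) atTop (𝓝 (p.outageOnOff s)))) ∧
    (p.phi s ≤ 1 →
      Tendsto (N.availProb s) atTop (𝓝 1) ∧
      (p.W₁ ≠ p.W₂ → Tendsto (N.outageProb s) atTop (𝓝 (p.outageAlways s)))) := by
  -- The outage probability with a silent relay; `outageOnOff` is the mixture of `outageAlways` and
  -- v with weights 1 / `phi` and 1 - 1 / `phi`.
  set v := (1 - Real.exp (-p.W₄ * p.Gth)) * (1 - p.expAck s)
    + Real.exp (-p.W₄ * p.Gth) * (1 - Real.exp (-p.W₂ * p.Gth)) with hv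
  have hout : p.W₁ ≠ p.W₂ → ∀ i, N.outageProb s i
      = N.availProb s i * p.outageAlways s + (1 - N.availProb s i) * v := fun hW =>
    N.outageProb_eq s (p.slotLaw_real_outageEvent_of_le s hW) (p.slotLaw_real_outageEvent_of_lt s)
  have hlim : p.W₁ ≠ p.W₂ → ∀ a, Tendsto (N.availProb s) atTop (𝓝 a) →
      Tendsto (N.outageProb s) atTop (𝓝 (a * p.outageAlways s + (1 - a) * v)) := fun hW a ha =>
    ((ha.mul_const _).add ((ha.const_sub 1).mul_const v)).congr fun i => (hout hW i).symm
  constructor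
  · intro hphi
    obtain ⟨hex, hval⟩ := p.existsUnique_isStationaryLaw s hphi
    have havail : Tendsto (N.availProb s) atTop (𝓝 (1 / p.phi s)) := by
      obtain ⟨π, hπ, -⟩ := hex
      have := hπ.isProb
      have h := p.tendsto_iterate_nextLaw_sub s hphi measurableSet_Ici (P.map N.B₀) π
        N.map_B₀_nonneg hπ.nonneg (S := Ici p.M)
      simp_rw [p.isStationaryLaw_iterate s hπ, hval π hπ, ← N.availProb_eq] at h
      simpa using h.add_const (1 / p.phi s)
    have hmix : 1 / p.phi s * p.outageAlways s + (1 - 1 / p.phi s) * v = p.outageOnOff s := by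
      rw [hv]
      unfold IOFP.Params.outageAlways IOFP.Params.outageOnOff
      ring
    refine ⟨hex, hval, havail, fun hW => ⟨fun hst i => ?_, ?_⟩⟩
    · rw [hout hW, N.availProb_eq, p.isStationaryLaw_iterate s hst, hval _ hst, hmix]
    · rw [← hmix]
      exact hlim hW _ havail
  · intro hphi
    have havail : Tendsto (N.availProb s) atTop (𝓝 1) := by
      have h := p.tendsto_iterate_nextLaw_real_Ici s hphi (P.map N.B₀) N.map_B₀_nonneg
      simp_rw [← N.availProb_eq] at h
      exact h
    refine ⟨havail, fun hW => ?_⟩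
    simpa using hlim hW 1 havail
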